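/- **Setting.** Let $d=2^Q$ be the dimension of the space of $Q$ qubits. In a $Q$-qubit $k$-round protocol between nodes $A$ and $B$, in every round $j=1,\dots,k$ any subset of the qubits may be moved between the nodes, all qubits are stored, and then $A$ and $B$ apply arbitrary unitary gates $G_{A_j}$, $G_{B_j}$ to the qubits that they hold after the move. With $G_j = G_{A_j}\otimes G_{B_j}$ (as a unitary channel on all $Q$ qubits), the ideal protocol is $\mathcal P^{k,(Q)}=\bigcirc_{j=1}^k G_j\circ M_j^{\otimes Q}$, where the ideal transmission acts as the identity on the state and the ideal memory $M_j$ is a one-qubit unitary channel (the identity for a perfect memory). **Noise model.** For each round $j$ there are one-qubit channels (completely positive trace-preserving maps) $\tilde{\mathcal E}_j$ (transmission), $\tilde M_j$ (memory) and $N_j$ (gate noise), which may differ from round to round but do not depend on the gates and are the same for all $Q$ qubits on both nodes. The noisy protocol is $\tilde{\mathcal P}^{k,(Q)}=\bigcirc_{j=1}^k G_j\circ N_j^{\otimes Q}\circ\tilde M_j^{\otimes Q}\circ\tilde{\mathcal E}_j^{\otimes Q}$. **Test.** The ideal and noisy depth-$\kappa$ tests with $Q$-qubit unitary gates $C_1,\dots,C_\kappa$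 are $\mathcal T^{\kappa,(Q)}=\bigcirc_{j=1}^\kappa C_j\circ M_j^{\otimes Q}$ and $\tilde{\mathcal T}^{\kappa,(Q)}=\bigcirc_{j=1}^\kappa C_j\circ N_j^{\otimes Q}\circ\tilde M_j^{\otimes Q}\circ\tilde{\mathcal E}_j^{\otimes Q}$, with the same noise. The double-averaged fidelity of the test is $$R(\tilde{\mathcal T}^{\kappa,(Q)})=\int dC_1\cdots\int dC_\kappa\int d\psi\ \mathrm{Tr}\big[\tilde{\mathcal T}^{\kappa,(Q)}(|\psi\rangle\langle\psi|)\,\mathcal T^{\kappa,(Q)}(|\psi\rangle\langle\psi|)\big],$$ with Haar probability measures on $U(d)$ and on pure $Q$-qubit states. Let $|\mathsf{Cliff}(d)|$ be the order of the $Q$-qubit Clifford group modulo global phases, and let $\|\Phi-\Psi\|_\diamond=\sup_\rho\|(\Phi\otimes\mathrm{id})(\rho)-(\Psi\otimes\mathrm{id})(\rho)\|_1$, where $\|\cdot\|_1$ is the trace norm and $\rho$ ranges over all density matrices of the system with a finite-dimensional reference system. **Theorem.** For every $Q$-qubit $k$-round protocol and every noise model as above, $$\|\tilde{\mathcal P}^{k,(Q)}-\mathcal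 P^{k,(Q)}\|_\diamond\ \le\ 2\sqrt{d(d+1)}\ \sum_{\kappa=1}^{k}\sqrt{|\mathsf{Cliff}(d)|^{\kappa}\big(1-R(\tilde{\mathcal T}^{\kappa,(Q)})\big)},$$ and the term $\kappa=k$ of the right-hand side alone is already an upper bound: $\|\tilde{\mathcal P}^{k,(Q)}-\mathcal P^{k,(Q)}\|_\diamond\le 2\sqrt{d(d+1)}\sqrt{|\mathsf{Cliff}(d)|^{k}(1-R(\tilde{\mathcal T}^{k,(Q)}))}$. Moreover, $R(\tilde{\mathcal T}^{\kappa,(Q)})$ may be replaced by an empirical estimate. For $\kappa=1,\dots,k$ let $\epsilon_\kappa\ge 0$, and let $R_\kappa$ be the fraction of accepted runs among $n_\kappa\ge1$ independent executions of the depth-$\kappa$ test, where in each execution the input state $\psi$ is uniform in a projective 2-design of $Q$-qubit states, $C_1,\dots,C_\kappa$ are independent and uniform in the Clifford group, and the run is accepted with probability $\mathrm{Tr}[\tilde{\mathcal T}^{\kappa,(Q)}(|\psi\rangle\langle\psi|)\,\mathcal T^{\kappa,(Q)}(|\psi\rangle\langle\psi|)]$. Then, with probability at least $1-\sum_{\kappa=1}^k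 e^{-2n_\kappa\epsilon_\kappa^2}$, $$\|\tilde{\mathcal P}^{k,(Q)}-\mathcal P^{k,(Q)}\|_\diamond\ \le\ 2\sqrt{d(d+1)}\ \sum_{\kappa=1}^{k}\sqrt{|\mathsf{Cliff}(d)|^{\kappa}\big(1-R_\kappa+\epsilon_\kappa\big)}.$$ -/

import Mathlib

open Matrix MeasureTheory ProbabilityTheory
open scoped ENNReal Kronecker ComplexOrder

noncomputable section

namespace PingPong

/-! ### Channels, trace norm, diamond distance -/

/-- Linear maps on complex `n × n` matrices (superoperators). -/
abbrev Superop (n : Type) [Fintype n] [DecidableEq n] : Type :=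
  Module.End ℂ (Matrix n n ℂ)

section Channels

variable {n : Type} [Fintype n] [DecidableEq n]

/-- `Φ ⊗ id` acting on matrices over the composite system `n × m`. -/
def ampliate (Φ : Superop n) (m : Type) (X : Matrix (n × m) (n × m) ℂ) :
    Matrix (n × m) (n × m) ℂ :=
  Matrix.of fun p q => Φ (Matrix.of fun a b => X (a, p.2) (b, q.2)) p.1 q.1

/-- A quantum channel: a completely positive trace-preserving linear map. -/
structure IsChannel (Φ : Superop n) : Prop where
  completelyPositive : ∀ (m : ℕ) (X : Matrix (n × Fin m) (n × Fin m) ℂ),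
    X.PosSemidef → (ampliate Φ (Fin m) X).PosSemidef
  tracePreserving : ∀ X : Matrix n n ℂ, (Φ X).trace = X.trace

/-- The unitary channel `X ↦ U X Uᴴ`. -/
def unitaryChannel (U : unitaryGroup n ℂ) : Superop n where
  toFun X := (U : Matrix n n ℂ) * X * (U : Matrix n n ℂ)ᴴ
  map_add' X Y := by simp [Matrix.mul_add, Matrix.add_mul]
  map_smul' c X := by simp

/-- The trace norm `‖A‖₁ = Tr √(Aᴴ A)`, the sum of the singular values of `A`. -/
def traceNorm (A : Matrix n n ℂ) : ℝ :=
  ∑ i, Real.sqrt ((isHermitian_conjTranspose_mul_self A).eigenvalues i)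

/-- Density matrices. -/
def IsDensity (ρ : Matrix n n ℂ) : Prop := ρ.PosSemidef ∧ ρ.trace = 1

/-- The diamond distance `sup_ρ ‖(Φ ⊗ id)(ρ) - (Ψ ⊗ id)(ρ)‖₁`, over all density matrices `ρ` of
the system together with a reference system of arbitrary finite dimension. The supremum is taken
in `[0, ∞]`. -/
def diamondDist (Φ Ψ : Superop n) : ℝ≥0∞ :=
  ⨆ (m : ℕ) (ρ : Matrix (n × Fin m) (n × Fin m) ℂ) (_ : IsDensity ρ),
    ENNReal.ofReal (traceNorm (ampliate Φ (Fin m) ρ - ampliate Ψ (Fin m) ρ))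

/-- The ordered composition `f (k-1) ∘ ⋯ ∘ f 1 ∘ f 0`. -/
def compose : (k : ℕ) → (Fin k → Superop n) → Superop n
  | 0, _ => LinearMap.id
  | k + 1, f => f (Fin.last k) ∘ₗ compose k (fun j => f j.castSucc)

end Channels

/-! ### The Haar measure on the unitary group and on pure states -/

section Haar

variable {n : Type} [Fintype n] [DecidableEq n]

instance : MeasurableSpace (unitaryGroup n ℂ) := borel _

instance : BorelSpace (unitaryGroup n ℂ) := ⟨rfl⟩

instance : CompactSpace (unitaryGroup n ℂ) := by
  refine isCompact_iff_compactSpace.mp ?_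
  refine IsCompact.of_isClosed_subset
    (isCompact_univ_pi fun _ : n => isCompact_univ_pi fun _ : n =>
      isCompact_closedBall (0 : ℂ) 1) isClosed_unitary ?_
  intro U hU i _ j _
  simpa using entry_norm_bound_of_unitary hU i j

/-- The Haar probability measure on the unitary group. -/
def haarUnitary (n : Type) [Fintype n] [DecidableEq n] : Measure (unitaryGroup n ℂ) :=
  Measure.haarMeasure ⊤

instance : IsProbabilityMeasure (haarUnitary n) :=
  ⟨by simpa [haarUnitary] using
    Measure.haarMeasure_self (K₀ := (⊤ : TopologicalSpace.PositiveCompacts (unitaryGroup n ℂ)))⟩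

end Haar

/-- Computational basis of `Q` qubits; the Hilbert space has dimension `2 ^ Q`. -/
abbrev Qubits (Q : ℕ) : Type := Fin Q → Fin 2

/-- The pure state `|ψ⟩⟨ψ|` with `ψ = U |0…0⟩`. For Haar-distributed `U` this is the Haar-random
(i.e. unitarily invariantly distributed) pure state of `Q` qubits. -/
def pureState {Q : ℕ} (U : unitaryGroup (Qubits Q) ℂ) : Matrix (Qubits Q) (Qubits Q) ℂ :=
  unitaryChannel U (Matrix.single 0 0 1)

/-- The average fidelity `∫ dψ Tr[Φ(|ψ⟩⟨ψ|) Ψ(|ψ⟩⟨ψ|)]` of the noisy `Φ` to the ideal `Ψ`. -/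
def avgFidelity {Q : ℕ} (Φ Ψ : Superop (Qubits Q)) : ℝ :=
  ∫ U, ((Φ (pureState U) * Ψ (pureState U)).trace).re ∂(haarUnitary (Qubits Q))

/-- A finite family of unit vectors, taken with uniform weights, is a projective 2-design:
`(1/|ι|) ∑ᵢ |xᵢ⟩⟨xᵢ|^{⊗2} = ∫ dψ |ψ⟩⟨ψ|^{⊗2}` (entrywise). -/
structure IsProjectiveTwoDesign {Q : ℕ} {ι : Type*} [Fintype ι] (x : ι → Qubits Q → ℂ) :
    Prop where
  unit : ∀ i, star (x i) ⬝ᵥ x i = 1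
  design : ∀ a b : Qubits Q × Qubits Q,
    (Fintype.card ι : ℂ)⁻¹ *
        ∑ i, (vecMulVec (x i) (star (x i)) ⊗ₖ vecMulVec (x i) (star (x i))) a b
      = ∫ U, (pureState U ⊗ₖ pureState U) a b ∂(haarUnitary (Qubits Q))

/-! ### The Clifford group -/

/-- The four one-qubit Pauli matrices `1, X, Y, Z`. -/
def pauli : Fin 4 → Matrix (Fin 2) (Fin 2) ℂ :=
  ![!![1, 0; 0, 1], !![0, 1; 1, 0], !![0, -Complex.I; Complex.I, 0], !![1, 0; 0, -1]]

/-- Pauli strings `σ_{p 0} ⊗ ⋯ ⊗ σ_{p (Q-1)}`. -/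
def pauliString {Q : ℕ} (p : Fin Q → Fin 4) : Matrix (Qubits Q) (Qubits Q) ℂ :=
  Matrix.of fun a b => ∏ i, pauli (p i) (a i) (b i)

/-- Clifford unitaries: conjugation maps every Pauli string to a Pauli string up to sign. -/
def IsClifford {Q : ℕ} (U : unitaryGroup (Qubits Q) ℂ) : Prop :=
  ∀ p : Fin Q → Fin 4, ∃ q : Fin Q → Fin 4,
    unitaryChannel U (pauliString p) = pauliString q ∨
      unitaryChannel U (pauliString p) = -pauliString q

/-- The Clifford group `Cliff(2^Q)`, as the (finite) set of channels `X ↦ C X Cᴴ` for Clifford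
unitaries `C`; so unitaries that differ by a global phase are identified. -/
def cliffordGroup (Q : ℕ) : Set (Superop (Qubits Q)) :=
  {Φ | ∃ U : unitaryGroup (Qubits Q) ℂ, IsClifford U ∧ Φ = unitaryChannel U}

/-! ### Noise model -/

/-- The product `Φ^{⊗Q}` of a one-qubit map:
`Φ^{⊗Q}(⊗ᵢ |cᵢ⟩⟨dᵢ|) = ⊗ᵢ Φ(|cᵢ⟩⟨dᵢ|)`, extended linearly. -/
def tensorPower (Q : ℕ) (Φ : Superop (Fin 2)) : Superop (Qubits Q) where
  toFun X := Matrix.of fun a b =>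
    ∑ c : Qubits Q, ∑ d : Qubits Q,
      (∏ i, Φ (Matrix.single (c i) (d i) 1) (a i) (b i)) * X c d
  map_add' X Y := by
    ext a b
    simp [mul_add, Finset.sum_add_distrib]
  map_smul' r X := by
    ext a b
    simp only [Matrix.of_apply, Matrix.smul_apply, smul_eq_mul, RingHom.id_apply, Finset.mul_sum]
    exact Finset.sum_congr rfl fun c _ => Finset.sum_congr rfl fun d _ => by ring

/-- A product noise model, the same for all qubits in a round and independent of the gates. In
round `j`, every qubit undergoes the noisy transmission `send j`, the noisy storage `store j` and
the noise `gateNoise j` that precedes the ideal gate. The ideal transmission only moves qubits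
between the nodes, hence acts as the identity on the state; the ideal storage acts on every
qubit as the unitary `memory j` (which is `1` for a perfect memory). -/
structure NoiseModel where
  memory : ℕ → unitaryGroup (Fin 2) ℂ
  send : ℕ → Superop (Fin 2)
  store : ℕ → Superop (Fin 2)
  gateNoise : ℕ → Superop (Fin 2)
  send_isChannel : ∀ j, IsChannel (send j)
  store_isChannel : ∀ j, IsChannel (store j)
  gateNoise_isChannel : ∀ j, IsChannel (gateNoise j)

/-- Ideal round `j`: perfect transmission and storage of all `Q` qubits, then the gate `g`. -/
def idealRound {Q : ℕ} (𝒩 : NoiseModel) (j : ℕ) (g : Superop (Qubits Q)) : Superop (Qubits Q) :=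
  g ∘ₗ tensorPower Q (unitaryChannel (𝒩.memory j))

/-- Noisy round `j`: noisy transmission, noisy storage, gate noise, then the ideal gate `g`. -/
def noisyRound {Q : ℕ} (𝒩 : NoiseModel) (j : ℕ) (g : Superop (Qubits Q)) : Superop (Qubits Q) :=
  g ∘ₗ tensorPower Q (𝒩.gateNoise j) ∘ₗ tensorPower Q (𝒩.store j) ∘ₗ tensorPower Q (𝒩.send j)

/-- The ideal `k` rounds with gates `g 0, …, g (k-1)`. -/
def idealRun {Q k : ℕ} (𝒩 : NoiseModel) (g : Fin k → Superop (Qubits Q)) : Superop (Qubits Q) :=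
  compose k fun j => idealRound 𝒩 j (g j)

/-- The noisy `k` rounds with gates `g 0, …, g (k-1)`. -/
def noisyRun {Q k : ℕ} (𝒩 : NoiseModel) (g : Fin k → Superop (Qubits Q)) : Superop (Qubits Q) :=
  compose k fun j => noisyRound 𝒩 j (g j)

/-! ### `Q`-qubit `k`-round protocols -/

/-- `G_A ⊗ G_B` for operators on the qubits in `S` and on the qubits not in `S`. -/
def bipartite {Q : ℕ} (S : Finset (Fin Q))
    (GA : Matrix ({i // i ∈ S} → Fin 2) ({i // i ∈ S} → Fin 2) ℂ)
    (GB : Matrix ({i // i ∉ S} → Fin 2) ({i // i ∉ S} → Fin 2) ℂ) :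
    Matrix (Qubits Q) (Qubits Q) ℂ :=
  Matrix.of fun a b => GA (fun i => a i) (fun i => b i) * GB (fun i => a i) (fun i => b i)

/-- A `Q`-qubit `k`-round protocol between nodes `A` and `B`. After the sending step of round `j`
node `A` holds the qubits in `atA j` and `B` holds the others; then `A` and `B` apply arbitrary
unitary gates to the qubits that they hold. -/
structure Protocol (Q k : ℕ) where
  atA : Fin k → Finset (Fin Q)
  gateA : ∀ j, unitaryGroup ({i // i ∈ atA j} → Fin 2) ℂ
  gateB : ∀ j, unitaryGroup ({i // i ∉ atA j} → Fin 2) ℂ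

/-- The ideal channel `G_A ⊗ G_B` of round `j`. -/
def Protocol.gate {Q k : ℕ} (P : Protocol Q k) (j : Fin k) : Superop (Qubits Q) where
  toFun X := bipartite (P.atA j) (P.gateA j) (P.gateB j) * X *
    (bipartite (P.atA j) (P.gateA j) (P.gateB j))ᴴ
  map_add' X Y := by simp [Matrix.mul_add, Matrix.add_mul]
  map_smul' c X := by simp

/-- The ideal protocol map `P^{k,(Q)}`. -/
def Protocol.ideal {Q k : ℕ} (P : Protocol Q k) (𝒩 : NoiseModel) : Superop (Qubits Q) :=
  idealRun 𝒩 P.gate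

/-- The noisy protocol map. -/
def Protocol.noisy {Q k : ℕ} (P : Protocol Q k) (𝒩 : NoiseModel) : Superop (Qubits Q) :=
  noisyRun 𝒩 P.gate

/-! ### The `Q`-qubit ping-pong test of depth `κ` -/

/-- The double-averaged fidelity of the depth-`κ` test: the average fidelity of the noisy test to
the ideal test, averaged over independent Haar-random `Q`-qubit gates. -/
def doubleAvgFidelity (Q : ℕ) (𝒩 : NoiseModel) (κ : ℕ) : ℝ :=
  ∫ U : Fin κ → unitaryGroup (Qubits Q) ℂ,
    avgFidelity (noisyRun 𝒩 fun j => unitaryChannel (U j))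
      (idealRun 𝒩 fun j => unitaryChannel (U j))
    ∂(Measure.pi fun _ => haarUnitary (Qubits Q))

/-- Probability that one execution of the depth-`κ` test with input state `ψ` and gates `c` is
accepted: the output of the noisy test is measured with the projector onto the ideal output. -/
def acceptProb {Q κ : ℕ} (𝒩 : NoiseModel) (ψ : Qubits Q → ℂ) (c : Fin κ → Superop (Qubits Q)) :
    ℝ :=
  ((noisyRun 𝒩 c (vecMulVec ψ (star ψ)) * idealRun 𝒩 c (vecMulVec ψ (star ψ))).trace).re

/-- Success probability of one execution of the depth-`κ` test: the input state is uniform in the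
family `x`, and the `κ` gates are independent and uniform in the Clifford group. -/
def successProb {Q : ℕ} {ι : Type*} [Fintype ι] (x : ι → Qubits Q → ℂ) (𝒩 : NoiseModel)
    (κ : ℕ) : ℝ :=
  (Fintype.card ι : ℝ)⁻¹ * ∑ i, (((cliffordGroup Q).ncard : ℝ) ^ κ)⁻¹ *
    ∑ᶠ c : Fin κ → cliffordGroup Q, acceptProb 𝒩 (x i) fun j => (c j : Superop (Qubits Q))

/-- The outcome bits `v 0, …, v (N-1)` of `N` independent identical executions of the depth-`κ`
test; `true` stands for "accept". -/
structure IsTestRecord {Q : ℕ} {ι Ω : Type*} [Fintype ι] [MeasurableSpace Ω] (μ : Measure Ω)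
    (x : ι → Qubits Q → ℂ) (𝒩 : NoiseModel) (κ N : ℕ) (v : Fin N → Ω → Bool) : Prop where
  measurable : ∀ i, Measurable (v i)
  indep : iIndepFun v μ
  law : ∀ i, μ.real {ω | v i ω = true} = successProb x 𝒩 κ

/-- The winning rate: the fraction of accepted executions. -/
def winningRate {Ω : Type*} {N : ℕ} (v : Fin N → Ω → Bool) (ω : Ω) : ℝ :=
  (∑ i, if v i ω = true then (1 : ℝ) else 0) / N

end PingPong

end

/-! Write $d=2^Q$. Because the ideal memory is unitary, a noisy round is the ideal round preceded by
one error channel $\Lambda_j$ (`roundError`) that does not depend on the gates. Both sides of the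
bound are governed by the entanglement fidelities $F_j$ of these channels, or equivalently by
$p_j=(d^2F_j-1)/(d^2-1)$.

Test side: averaging a channel over the Clifford group leaves a depolarizing channel with parameter
$p_j$ (`clifford_twirl`). The random gate of one round twirls the error of the next round, the
random input twirls the first error, and the last gate cancels in the trace. Depolarizing parameters
multiply, so the fidelity of the depth-$k$ test is $1/d+(1-1/d)\prod_{j<k}p_j$, both for Haar
averages (`doubleAvgFidelity_eq`) and for Clifford gates with a 2-design (`successProb_eq`). Haar
integrals reduce to finite Clifford sums by left invariance.

Protocol side: telescoping over the rounds bounds the diamond distance by $\sum_j(d+\sqrt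
d+1)\sqrt{1-F_j}$ (`diamondDist_compose_le`), uniformly in the gates and in the reference system.

Comparison: since $-1/3\le p_j\le 1$, each $1-p_j$ is at most $2(1-\prod_i p_i)$, so the single
number for depth $k$ controls every round. What remains is a factor of order $k$, which
$|\mathsf{Cliff}(d)|^{k/2}\ge 2^k$ absorbs (`sum_error_le`). Thus the term $\kappa=k$ alone
suffices, and the full sum is larger. The empirical version adds Hoeffding's inequality at depth $k$
only.

The twirl needs no representation theory. Sums $\sum_\Phi \mathrm{tr}(S\,\Phi(A)\,T\,\Phi(B))$ are
invariant under Clifford conjugation of $S,T$. Conjugation by Pauli strings kills the terms with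
different strings, the Cliffords $(\sigma_p+\sigma_r)/\sqrt2$ make all nontrivial diagonal terms
equal, and completeness of the Pauli strings fixes their common value. -/

noncomputable section

namespace PingPong

/-! ### Product operators and Pauli strings -/

section PauliStrings

variable {Q : ℕ}

/-- The tensor product of one-qubit matrices. -/
def tensorMatrix (A : Fin Q → Matrix (Fin 2) (Fin 2) ℂ) : Matrix (Qubits Q) (Qubits Q) ℂ :=
  Matrix.of fun a b => ∏ i, A i (a i) (b i)

theorem tensorMatrix_apply (A : Fin Q → Matrix (Fin 2) (Fin 2) ℂ) (a b : Qubits Q) :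
    tensorMatrix A a b = ∏ i, A i (a i) (b i) := rfl

theorem prod_sum_eq_sum_prod {α : Type} [Fintype α] (f : Fin Q → α → ℂ) :
    ∏ i, ∑ x, f i x = ∑ x : Fin Q → α, ∏ i, f i (x i) := by
  rw [Finset.prod_univ_sum, Fintype.piFinset_univ]

theorem tensorMatrix_mul (A B : Fin Q → Matrix (Fin 2) (Fin 2) ℂ) :
    tensorMatrix A * tensorMatrix B = tensorMatrix fun i => A i * B i := by
  ext a b
  simp only [Matrix.mul_apply, tensorMatrix_apply, prod_sum_eq_sum_prod, Finset.prod_mul_distrib]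

theorem tensorMatrix_conjTranspose (A : Fin Q → Matrix (Fin 2) (Fin 2) ℂ) :
    (tensorMatrix A)ᴴ = tensorMatrix fun i => (A i)ᴴ := by
  ext a b
  simp [tensorMatrix_apply, Matrix.conjTranspose_apply]

theorem prod_ite_eq_ite (a b : Qubits Q) :
    ∏ i, (if a i = b i then (1 : ℂ) else 0) = if a = b then 1 else 0 := by
  rw [Finset.prod_ite_zero]
  simp [funext_iff]

theorem tensorMatrix_one : tensorMatrix (fun _ : Fin Q => (1 : Matrix (Fin 2) (Fin 2) ℂ)) = 1 := by
  ext a b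
  simp only [tensorMatrix_apply, Matrix.one_apply, prod_ite_eq_ite]

theorem tensorMatrix_smul (z : Fin Q → ℂ) (A : Fin Q → Matrix (Fin 2) (Fin 2) ℂ) :
    tensorMatrix (fun i => z i • A i) = (∏ i, z i) • tensorMatrix A := by
  ext a b
  simp [tensorMatrix_apply, Finset.prod_mul_distrib]

theorem pauliString_eq (p : Fin Q → Fin 4) : pauliString p = tensorMatrix fun i => pauli (p i) :=
  rfl

theorem pauli_zero : pauli 0 = 1 := by
  ext i j; fin_cases i <;> fin_cases j <;> simp [pauli]

theorem pauli_mul_self (a : Fin 4) : pauli a * pauli a = 1 := by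
  fin_cases a <;> ext i j <;> fin_cases i <;> fin_cases j <;>
    simp [pauli, Matrix.mul_apply, Fin.sum_univ_two]

theorem pauli_conjTranspose (a : Fin 4) : (pauli a)ᴴ = pauli a := by
  fin_cases a <;> ext i j <;> fin_cases i <;> fin_cases j <;>
    simp [pauli]

theorem exists_pauli_mul (a b : Fin 4) : ∃ (c : Fin 4) (z : ℂ), pauli a * pauli b = z • pauli c := by
  have key : ∀ c z, (∀ i j, (pauli a * pauli b) i j = z * pauli c i j) →
      ∃ (c : Fin 4) (z : ℂ), pauli a * pauli b = z • pauli c := fun c z h =>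
    ⟨c, z, by ext i j; simpa using h i j⟩
  fin_cases a <;> fin_cases b
  on_goal 1 => apply key 0 1
  on_goal 2 => apply key 1 1
  on_goal 3 => apply key 2 1
  on_goal 4 => apply key 3 1
  on_goal 5 => apply key 1 1
  on_goal 6 => apply key 0 1
  on_goal 7 => apply key 3 Complex.I
  on_goal 8 => apply key 2 (-Complex.I)
  on_goal 9 => apply key 2 1
  on_goal 10 => apply key 3 (-Complex.I)
  on_goal 11 => apply key 0 1
  on_goal 12 => apply key 1 Complex.I
  on_goal 13 => apply key 3 1
  on_goal 14 => apply key 2 Complex.I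
  on_goal 15 => apply key 1 (-Complex.I)
  on_goal 16 => apply key 0 1
  all_goals
    intro i j
    fin_cases i <;> fin_cases j <;> simp [pauli, Matrix.mul_apply, Fin.sum_univ_two]

/-- The sign `s` with `σ_a σ_b = s σ_b σ_a`. -/
def pauliSign (a b : Fin 4) : ℤ := if a = 0 ∨ b = 0 ∨ a = b then 1 else -1

theorem pauli_mul_comm (a b : Fin 4) :
    pauli a * pauli b = (pauliSign a b : ℂ) • (pauli b * pauli a) := by
  fin_cases a <;> fin_cases b <;> ext i j <;> fin_cases i <;> fin_cases j <;>
    simp [pauli, pauliSign, Matrix.mul_apply, Fin.sum_univ_two]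

/-- This is $\sum_a\sigma_a\otimes\sigma_a=2\,\mathrm{SWAP}$ in coordinates. -/
theorem sum_pauli_mul_pauli (i j k l : Fin 2) :
    ∑ a, pauli a i j * pauli a k l = if i = l ∧ j = k then 2 else 0 := by
  fin_cases i <;> fin_cases j <;> fin_cases k <;> fin_cases l <;>
    simp [pauli, Fin.sum_univ_four] <;> norm_num

/-- The sign `s` with `σ_p σ_q = s σ_q σ_p` for Pauli strings. -/
def stringSign (p q : Fin Q → Fin 4) : ℤ := ∏ i, pauliSign (p i) (q i)

theorem pauliString_zero : pauliString (0 : Fin Q → Fin 4) = 1 := by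
  simp only [pauliString_eq, Pi.zero_apply, pauli_zero, tensorMatrix_one]

theorem pauliString_mul_self (p : Fin Q → Fin 4) : pauliString p * pauliString p = 1 := by
  simp only [pauliString_eq, tensorMatrix_mul, pauli_mul_self, tensorMatrix_one]

theorem pauliString_conjTranspose (p : Fin Q → Fin 4) : (pauliString p)ᴴ = pauliString p := by
  simp only [pauliString_eq, tensorMatrix_conjTranspose, pauli_conjTranspose]

theorem pauliString_mul_comm (p q : Fin Q → Fin 4) :
    pauliString p * pauliString q = (stringSign p q : ℂ) • (pauliString q * pauliString p) := by
  simp only [pauliString_eq, tensorMatrix_mul, pauli_mul_comm (p _) (q _), tensorMatrix_smul,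
    stringSign, Int.cast_prod]

theorem exists_pauliString_mul (p q : Fin Q → Fin 4) :
    ∃ (r : Fin Q → Fin 4) (z : ℂ), pauliString p * pauliString q = z • pauliString r := by
  choose c z h using exists_pauli_mul
  refine ⟨fun i => c (p i) (q i), ∏ i, z (p i) (q i), ?_⟩
  simp only [pauliString_eq, tensorMatrix_mul, h, tensorMatrix_smul]

/-- The sum over strings factors over the qubits, so the one-qubit swap identity tensorizes. The two
completeness statements that follow are contractions of it. -/
theorem sum_pauliString_mul (a b c d : Qubits Q) :
    ∑ p : Fin Q → Fin 4, pauliString p a b * pauliString p c d =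
      if a = d ∧ b = c then 2 ^ Q else 0 := by
  simp only [pauliString_eq, tensorMatrix_apply, ← Finset.prod_mul_distrib]
  rw [← prod_sum_eq_sum_prod (fun i x => pauli x (a i) (b i) * pauli x (c i) (d i))]
  simp only [sum_pauli_mul_pauli]
  rw [Finset.prod_ite_zero]
  simp [funext_iff, forall_and]

/-- Completeness of the Pauli strings. -/
theorem sum_pauliString_conj (X : Matrix (Qubits Q) (Qubits Q) ℂ) :
    ∑ p : Fin Q → Fin 4, pauliString p * X * pauliString p = ((2 : ℂ) ^ Q * X.trace) • 1 := by
  ext a b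
  simp only [Matrix.sum_apply, Matrix.mul_apply, Finset.sum_mul, Matrix.smul_apply, smul_eq_mul]
  rw [Finset.sum_comm]
  have h : ∀ x, ∑ p : Fin Q → Fin 4, ∑ y, pauliString p a y * X y x * pauliString p x b =
      (2 ^ Q * X x x) * (1 : Matrix (Qubits Q) (Qubits Q) ℂ) a b := by
    intro x
    rw [Finset.sum_comm]
    have h' : ∀ y, ∑ p : Fin Q → Fin 4, pauliString p a y * X y x * pauliString p x b =
        if y = x then (2 ^ Q * X x x) * (1 : Matrix (Qubits Q) (Qubits Q) ℂ) a b else 0 := by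
      intro y
      have := sum_pauliString_mul a y x b
      simp only [mul_right_comm _ (X y x), ← Finset.sum_mul, this]
      split_ifs with h1 h2 h2
      · obtain ⟨rfl, rfl⟩ := h1; simp
      · exact absurd h1.2 h2
      · have : a ≠ b := fun h => h1 ⟨h, h2⟩
        simp [this]
      · simp
    simp [h']
  rw [Finset.sum_congr rfl fun x _ => h x, ← Finset.sum_mul, ← Finset.mul_sum]
  rfl

/-- Expansion of a matrix in Pauli strings. -/
theorem pauliString_expansion (X : Matrix (Qubits Q) (Qubits Q) ℂ) :
    X = ∑ p : Fin Q → Fin 4, (((2 : ℂ) ^ Q)⁻¹ * (pauliString p * X).trace) • pauliString p := by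
  ext a b
  simp only [Matrix.sum_apply, Matrix.smul_apply, smul_eq_mul, Matrix.trace, Matrix.diag,
    Matrix.mul_apply, Finset.mul_sum, Finset.sum_mul]
  rw [Finset.sum_comm]
  have h : ∀ x, ∑ p : Fin Q → Fin 4, ∑ y,
      (((2 : ℂ) ^ Q)⁻¹ * (pauliString p x y * X y x)) * pauliString p a b =
      if x = b then X a b else 0 := by
    intro x
    rw [Finset.sum_comm]
    have h' : ∀ y, ∑ p : Fin Q → Fin 4,
        (((2 : ℂ) ^ Q)⁻¹ * (pauliString p x y * X y x)) * pauliString p a b =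
        if y = a then (if x = b then X a b else 0) else 0 := by
      intro y
      have := sum_pauliString_mul x y a b
      have e : ∀ p : Fin Q → Fin 4,
          (((2 : ℂ) ^ Q)⁻¹ * (pauliString p x y * X y x)) * pauliString p a b =
          (((2 : ℂ) ^ Q)⁻¹ * X y x) * (pauliString p x y * pauliString p a b) := fun p => by ring
      simp only [e, ← Finset.mul_sum, this]
      by_cases h1 : y = a <;> by_cases h2 : x = b <;> simp [h1, h2]
      field_simp
    simp [h']
  simp [h]

theorem exists_pauliSign_ne {a b : Fin 4} (h : a ≠ b) :
    ∃ c, pauliSign c a ≠ pauliSign c b := by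
  revert a b; decide

theorem exists_pauliSign_neg (a b : Fin 4) (ha : a ≠ 0) (hb : b ≠ 0) :
    ∃ c, pauliSign a c = -1 ∧ pauliSign b c = -1 := by
  revert a b; decide

theorem pauliSign_zero (a : Fin 4) : pauliSign a 0 = 1 := by simp [pauliSign]

theorem zero_pauliSign (a : Fin 4) : pauliSign 0 a = 1 := by simp [pauliSign]

theorem pauliSign_eq_or (a b : Fin 4) : pauliSign a b = 1 ∨ pauliSign a b = -1 := by
  unfold pauliSign; split_ifs <;> simp

theorem stringSign_eq_or (p q : Fin Q → Fin 4) : stringSign p q = 1 ∨ stringSign p q = -1 := by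
  unfold stringSign
  refine Finset.prod_induction _ (fun x : ℤ => x = 1 ∨ x = -1) ?_ (Or.inl rfl)
    fun i _ => pauliSign_eq_or _ _
  rintro a b (rfl | rfl) (rfl | rfl) <;> simp

theorem stringSign_single_left (i : Fin Q) (c : Fin 4) (p : Fin Q → Fin 4) :
    stringSign (Pi.single i c) p = pauliSign c (p i) := by
  unfold stringSign
  rw [Finset.prod_eq_single i]
  · simp
  · intro j _ hj; simp [hj, zero_pauliSign]
  · simp

theorem exists_stringSign_ne {p q : Fin Q → Fin 4} (h : p ≠ q) :
    ∃ r, stringSign r p ≠ stringSign r q := by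
  obtain ⟨i, hi⟩ := Function.ne_iff.mp h
  obtain ⟨c, hc⟩ := exists_pauliSign_ne hi
  exact ⟨Pi.single i c, by simpa only [stringSign_single_left] using hc⟩

theorem stringSign_single_right (i : Fin Q) (c : Fin 4) (p : Fin Q → Fin 4) :
    stringSign p (Pi.single i c) = pauliSign (p i) c := by
  unfold stringSign
  rw [Finset.prod_eq_single i]
  · simp
  · intro j _ hj; simp [hj, pauliSign_zero]
  · simp

/-- Filling an empty slot of `r` multiplies the sign by that slot's contribution. This allows a
partner string to be built from two separate qubits. -/
theorem stringSign_update (r p : Fin Q → Fin 4) (i : Fin Q) (c : Fin 4) (h : r i = 0) :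
    stringSign p (Function.update r i c) = stringSign p r * pauliSign (p i) c := by
  unfold stringSign
  rw [← Finset.mul_prod_erase _ (fun j => pauliSign (p j) (Function.update r i c j))
      (Finset.mem_univ i),
    ← Finset.mul_prod_erase _ (fun j => pauliSign (p j) (r j)) (Finset.mem_univ i)]
  rw [Finset.prod_congr rfl (g := fun j => pauliSign (p j) (r j))]
  · simp [h, pauliSign_zero, mul_comm]
  · intro j hj
    rw [Function.update_of_ne (Finset.ne_of_mem_erase hj)]

/-- Two nontrivial Pauli strings have a common anticommuting partner. -/
theorem exists_stringSign_neg {p q : Fin Q → Fin 4} (hp : p ≠ 0) (hq : q ≠ 0) :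
    ∃ r, stringSign p r = -1 ∧ stringSign q r = -1 := by
  obtain ⟨i, hi⟩ := Function.ne_iff.mp hp
  obtain ⟨j, hj⟩ := Function.ne_iff.mp hq
  -- If some chosen qubit carries nontrivial letters of both strings, one letter there anticommutes
  -- with both. Otherwise one letter is placed at `i` and one at `j`, and each string sees only its
  -- own.
  by_cases hqi : q i = 0
  · by_cases hpj : p j = 0
    · obtain ⟨c, hc, -⟩ := exists_pauliSign_neg (p i) (p i) hi hi
      obtain ⟨e, he, -⟩ := exists_pauliSign_neg (q j) (q j) hj hj
      have hij : j ≠ i := by rintro rfl; exact hi hpj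
      have h0 : (Pi.single i c : Fin Q → Fin 4) j = 0 := by simp [hij]
      refine ⟨Function.update (Pi.single i c) j e, ?_, ?_⟩ <;>
        rw [stringSign_update _ _ _ _ h0, stringSign_single_right]
      · simp [hc, hpj, zero_pauliSign]
      · simp [he, hqi, zero_pauliSign]
    · obtain ⟨c, h1, h2⟩ := exists_pauliSign_neg (p j) (q j) hpj hj
      exact ⟨Pi.single j c, by simpa only [stringSign_single_right] using h1,
        by simpa only [stringSign_single_right] using h2⟩
  · obtain ⟨c, h1, h2⟩ := exists_pauliSign_neg (p i) (q i) hi hqi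
    exact ⟨Pi.single i c, by simpa only [stringSign_single_right] using h1,
      by simpa only [stringSign_single_right] using h2⟩

end PauliStrings

/-! ### The Clifford group and its twirl -/

section UnitaryChannels

variable {n : Type} [Fintype n] [DecidableEq n]

theorem unitaryChannel_apply (U : unitaryGroup n ℂ) (X : Matrix n n ℂ) :
    unitaryChannel U X = (U : Matrix n n ℂ) * X * (U : Matrix n n ℂ)ᴴ := rfl

theorem unitary_conjTranspose_mul_self (U : unitaryGroup n ℂ) :
    (U : Matrix n n ℂ)ᴴ * (U : Matrix n n ℂ) = 1 :=
  (Matrix.mem_unitaryGroup_iff').mp U.2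

theorem unitary_mul_conjTranspose_self (U : unitaryGroup n ℂ) :
    (U : Matrix n n ℂ) * (U : Matrix n n ℂ)ᴴ = 1 :=
  (Matrix.mem_unitaryGroup_iff).mp U.2

theorem unitaryChannel_mul (U V : unitaryGroup n ℂ) :
    unitaryChannel (U * V) = unitaryChannel U ∘ₗ unitaryChannel V := by
  ext1 X
  simp only [LinearMap.comp_apply, unitaryChannel_apply, Submonoid.coe_mul,
    Matrix.conjTranspose_mul, Matrix.mul_assoc]

theorem unitaryChannel_one : unitaryChannel (1 : unitaryGroup n ℂ) = LinearMap.id := by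
  ext1 X
  simp [unitaryChannel_apply]

theorem unitaryChannel_inv_comp (U : unitaryGroup n ℂ) :
    unitaryChannel U⁻¹ ∘ₗ unitaryChannel U = LinearMap.id := by
  rw [← unitaryChannel_mul, inv_mul_cancel, unitaryChannel_one]

theorem unitaryChannel_comp_inv (U : unitaryGroup n ℂ) :
    unitaryChannel U ∘ₗ unitaryChannel U⁻¹ = LinearMap.id := by
  rw [← unitaryChannel_mul, mul_inv_cancel, unitaryChannel_one]

theorem unitaryChannel_injective (U : unitaryGroup n ℂ) :
    Function.Injective (unitaryChannel U) := fun X Y h => by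
  simpa [← LinearMap.comp_apply, unitaryChannel_inv_comp] using
    congrArg (unitaryChannel U⁻¹) h

theorem unitaryChannel_mul_apply (U : unitaryGroup n ℂ) (X Y : Matrix n n ℂ) :
    unitaryChannel U X * unitaryChannel U Y = unitaryChannel U (X * Y) := by
  simp only [unitaryChannel_apply]
  calc _ = (U : Matrix n n ℂ) * X * ((U : Matrix n n ℂ)ᴴ * (U : Matrix n n ℂ)) * Y *
        (U : Matrix n n ℂ)ᴴ := by simp only [Matrix.mul_assoc]
    _ = _ := by rw [unitary_conjTranspose_mul_self]; simp only [Matrix.mul_assoc, Matrix.mul_one]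

theorem trace_unitaryChannel (U : unitaryGroup n ℂ) (X : Matrix n n ℂ) :
    (unitaryChannel U X).trace = X.trace := by
  rw [unitaryChannel_apply, Matrix.trace_mul_comm, ← Matrix.mul_assoc,
    unitary_conjTranspose_mul_self, Matrix.one_mul]

theorem trace_unitaryChannel_mul (U : unitaryGroup n ℂ) (X Y : Matrix n n ℂ) :
    (unitaryChannel U X * unitaryChannel U Y).trace = (X * Y).trace := by
  rw [unitaryChannel_mul_apply, trace_unitaryChannel]

end UnitaryChannels

section Clifford

variable {Q : ℕ}

theorem isClifford_mul {U V : unitaryGroup (Qubits Q) ℂ} (hU : IsClifford U)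
    (hV : IsClifford V) : IsClifford (U * V) := by
  intro p
  obtain ⟨q, hq⟩ := hV p
  obtain ⟨r, hr⟩ := hU q
  refine ⟨r, ?_⟩
  rw [unitaryChannel_mul, LinearMap.comp_apply]
  rcases hq with hq | hq <;> rcases hr with hr | hr <;> simp [hq, hr]

theorem superop_ext_pauliString {Φ Ψ : Superop (Qubits Q)}
    (h : ∀ p, Φ (pauliString p) = Ψ (pauliString p)) : Φ = Ψ := by
  ext1 X
  rw [pauliString_expansion X]
  simp [h]

/-- Pauli strings span, so a Clifford channel is determined by their images, which lie in a finite
set of signed strings. -/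
theorem cliffordGroup_finite : (cliffordGroup Q).Finite := by
  let S : Set (Matrix (Qubits Q) (Qubits Q) ℂ) :=
    Set.range pauliString ∪ Set.range fun q => -pauliString q
  have hS : S.Finite := (Set.finite_range _).union (Set.finite_range _)
  refine Set.Finite.of_finite_image (f := fun Φ p => Φ (pauliString p)) ?_ ?_
  · refine (Set.Finite.pi' fun _ : Fin Q → Fin 4 => hS).subset ?_
    rintro _ ⟨Φ, ⟨U, hU, rfl⟩, rfl⟩ p
    obtain ⟨q, hq | hq⟩ := hU p
    · exact Or.inl ⟨q, hq.symm⟩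
    · exact Or.inr ⟨q, hq.symm⟩
  · intro Φ _ Ψ _ h
    exact superop_ext_pauliString fun p => congrFun h p

instance : Finite (cliffordGroup Q) := cliffordGroup_finite

instance : Fintype (cliffordGroup Q) := Fintype.ofFinite _

/-- Left composition with a Clifford is an injective self-map of a finite set, hence a bijection;
closure under inverses is not needed. -/
theorem sum_cliffordGroup_comp {M : Type*} [AddCommMonoid M] {h : unitaryGroup (Qubits Q) ℂ}
    (hh : IsClifford h) (F : Superop (Qubits Q) → M) :
    ∑ Φ : cliffordGroup Q, F Φ = ∑ Φ : cliffordGroup Q, F (unitaryChannel h ∘ₗ Φ) := by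
  have hmem : ∀ Φ : cliffordGroup Q, unitaryChannel h ∘ₗ (Φ : Superop (Qubits Q)) ∈
      cliffordGroup Q := by
    rintro ⟨_, U, hU, rfl⟩
    exact ⟨h * U, isClifford_mul hh hU, (unitaryChannel_mul _ _).symm⟩
  let e : cliffordGroup Q → cliffordGroup Q := fun Φ => ⟨unitaryChannel h ∘ₗ Φ, hmem Φ⟩
  have he : Function.Injective e := by
    intro Φ Ψ hΦ
    have := congrArg Subtype.val hΦ
    ext1
    ext1 X
    exact unitaryChannel_injective h (LinearMap.congr_fun this X)
  exact (Function.Bijective.sum_comp (Finite.injective_iff_bijective.mp he)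
    fun Φ : cliffordGroup Q => F Φ).symm

/-- A Pauli string as a unitary. -/
def pauliUnitary (p : Fin Q → Fin 4) : unitaryGroup (Qubits Q) ℂ :=
  ⟨pauliString p, by
    rw [Matrix.mem_unitaryGroup_iff, Matrix.star_eq_conjTranspose, pauliString_conjTranspose,
      pauliString_mul_self]⟩

theorem pauliUnitary_channel (p q : Fin Q → Fin 4) :
    unitaryChannel (pauliUnitary p) (pauliString q) = (stringSign p q : ℂ) • pauliString q := by
  rw [unitaryChannel_apply]
  simp only [pauliUnitary, pauliString_conjTranspose]
  rw [pauliString_mul_comm, Matrix.smul_mul, Matrix.mul_assoc, pauliString_mul_self,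
    Matrix.mul_one]

theorem isClifford_pauliUnitary (p : Fin Q → Fin 4) : IsClifford (pauliUnitary p) := by
  intro q
  refine ⟨q, ?_⟩
  rw [pauliUnitary_channel]
  rcases stringSign_eq_or p q with h | h <;> simp [h]

theorem pauliString_ne_zero (p : Fin Q → Fin 4) : pauliString p ≠ 0 := by
  intro h
  have := pauliString_mul_self p
  rw [h] at this
  simp at this

/-- Conjugations by distinct Pauli strings differ, because some string tells them apart by a sign.
Beyond finiteness, this crude lower bound is all that is needed about the order of the group. -/
theorem pow_le_ncard_cliffordGroup (Q : ℕ) : 4 ^ Q ≤ (cliffordGroup Q).ncard := by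
  have hinj : Function.Injective fun p : Fin Q → Fin 4 => unitaryChannel (pauliUnitary p) := by
    intro p q h
    by_contra hpq
    obtain ⟨r, hr⟩ := exists_stringSign_ne hpq
    have hsymm : ∀ p : Fin Q → Fin 4, stringSign p r = stringSign r p := fun p =>
      Finset.prod_congr rfl fun i _ => by simp only [pauliSign, or_left_comm, eq_comm]
    have h2 := LinearMap.congr_fun h (pauliString r)
    simp only [pauliUnitary_channel] at h2
    have h3 := smul_left_injective ℂ (pauliString_ne_zero r) h2
    rw [hsymm, hsymm] at h3
    exact hr (by exact_mod_cast h3)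
  have hsub : Set.range (fun p : Fin Q → Fin 4 => unitaryChannel (pauliUnitary p)) ⊆
      cliffordGroup Q := by
    rintro _ ⟨p, rfl⟩
    exact ⟨_, isClifford_pauliUnitary p, rfl⟩
  have h := Set.ncard_le_ncard hsub cliffordGroup_finite
  have hc : (Set.range (fun p : Fin Q → Fin 4 => unitaryChannel (pauliUnitary p))).ncard =
      4 ^ Q := by
    rw [← Set.image_univ, Set.ncard_image_of_injective _ hinj, Set.ncard_univ]
    simp
  omega

/-! ### Clifford unitaries that exchange anticommuting Pauli strings -/

theorem inv_sqrt_two_mul_self : (((√2)⁻¹ : ℝ) : ℂ) * (((√2)⁻¹ : ℝ) : ℂ) = 1 / 2 := by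
  rw [← Complex.ofReal_mul, ← mul_inv, Real.mul_self_sqrt (by norm_num)]
  norm_num

theorem pauliString_mul_comm_neg {p r : Fin Q → Fin 4} (h : stringSign p r = -1) :
    pauliString p * pauliString r = -(pauliString r * pauliString p) := by
  rw [pauliString_mul_comm, h]; simp

theorem smul_conj_smul (X Y : Matrix (Qubits Q) (Qubits Q) ℂ) :
    ((((√2)⁻¹ : ℝ) : ℂ) • X) * Y * ((((√2)⁻¹ : ℝ) : ℂ) • X) = (1 / 2 : ℂ) • (X * Y * X) := by
  rw [Matrix.smul_mul, Matrix.smul_mul, Matrix.mul_smul, smul_smul, inv_sqrt_two_mul_self]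

/-- The Hermitian unitary `(σ_p + σ_r) / √2` for anticommuting Pauli strings. -/
def swapUnitary (p r : Fin Q → Fin 4) (h : stringSign p r = -1) : unitaryGroup (Qubits Q) ℂ :=
  ⟨(((√2)⁻¹ : ℝ) : ℂ) • (pauliString p + pauliString r), by
    rw [Matrix.mem_unitaryGroup_iff, Matrix.star_eq_conjTranspose, Matrix.conjTranspose_smul,
      Matrix.conjTranspose_add, pauliString_conjTranspose, pauliString_conjTranspose,
      RCLike.star_def, Complex.conj_ofReal]
    have h2 := smul_conj_smul (pauliString p + pauliString r) 1
    rw [Matrix.mul_one, Matrix.mul_one] at h2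
    rw [h2, add_mul, mul_add, mul_add, pauliString_mul_self, pauliString_mul_self,
      pauliString_mul_comm_neg h]
    have h3 : ∀ X : Matrix (Qubits Q) (Qubits Q) ℂ, 1 + -X + (X + 1) = (2 : ℂ) • 1 := fun X => by
      rw [two_smul]; abel
    rw [h3, smul_smul]
    norm_num⟩

theorem swapUnitary_channel (p r : Fin Q → Fin 4) (h : stringSign p r = -1)
    (X : Matrix (Qubits Q) (Qubits Q) ℂ) :
    unitaryChannel (swapUnitary p r h) X =
      (1 / 2 : ℂ) • ((pauliString p + pauliString r) * X * (pauliString p + pauliString r)) := by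
  rw [unitaryChannel_apply, swapUnitary, Matrix.conjTranspose_smul,
    Matrix.conjTranspose_add, pauliString_conjTranspose, pauliString_conjTranspose,
    RCLike.star_def, Complex.conj_ofReal, smul_conj_smul]

theorem half_smul_add_self (X : Matrix (Qubits Q) (Qubits Q) ℂ) :
    (1 / 2 : ℂ) • (X + X) = X := by
  rw [← two_smul ℂ X, smul_smul]; norm_num

theorem swapUnitary_channel_left (p r : Fin Q → Fin 4) (h : stringSign p r = -1) :
    unitaryChannel (swapUnitary p r h) (pauliString p) = pauliString r := by
  rw [swapUnitary_channel]
  have e : (pauliString p + pauliString r) * pauliString p * (pauliString p + pauliString r) =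
      pauliString p * pauliString p * pauliString p + pauliString p * pauliString p * pauliString r
        + pauliString r * (pauliString p * pauliString p)
        + pauliString r * (pauliString p * pauliString r) := by noncomm_ring
  rw [e, pauliString_mul_comm_neg h, mul_neg, ← mul_assoc, ← mul_assoc]
  simp only [pauliString_mul_self, Matrix.one_mul, mul_assoc, Matrix.mul_one]
  rw [show ∀ X Y : Matrix (Qubits Q) (Qubits Q) ℂ, X + Y + Y + -X = Y + Y from
    fun X Y => by abel, half_smul_add_self]

/-- If $\sigma_q$ commutes with both strings or anticommutes with both, it is fixed up to sign,
since $(\sigma_p+\sigma_r)^2=2$. In the mixed cases the image is $\pm\sigma_q\sigma_p\sigma_r$, a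
multiple of a Pauli string whose square is 1, so the multiple is $\pm1$. -/
theorem isClifford_swapUnitary (p r : Fin Q → Fin 4) (h : stringSign p r = -1) :
    IsClifford (swapUnitary p r h) := by
  intro q
  rw [swapUnitary_channel]
  have hA := pauliString_mul_self p
  have hB := pauliString_mul_self r
  have hX := pauliString_mul_self q
  have hXA := pauliString_mul_comm p q
  have hXB := pauliString_mul_comm r q
  have hAB := pauliString_mul_comm_neg h
  obtain ⟨t, z, hz⟩ : ∃ (t : Fin Q → Fin 4) (z : ℂ),
      pauliString q * (pauliString p * pauliString r) = z • pauliString t := by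
    obtain ⟨s, z, hs⟩ := exists_pauliString_mul p r
    obtain ⟨t, w, ht⟩ := exists_pauliString_mul q s
    exact ⟨t, z * w, by rw [hs, Matrix.mul_smul, ht, smul_smul]⟩
  have hT := pauliString_mul_self t
  have hone : (1 : Matrix (Qubits Q) (Qubits Q) ℂ) ≠ 0 := by
    rw [← pauliString_zero]; exact pauliString_ne_zero _
  -- No phases are tracked in products of strings: the scalar `z` is pinned down to a sign by
  -- $X^2=1$.
  have hzz : ∀ X : Matrix (Qubits Q) (Qubits Q) ℂ, X = z • pauliString t → X * X = 1 →
      X = pauliString t ∨ X = -pauliString t := by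
    intro X h1 h2
    rw [h1, Matrix.smul_mul, Matrix.mul_smul, hT, smul_smul] at h2
    have h3 : (z * z - 1) • (1 : Matrix (Qubits Q) (Qubits Q) ℂ) = 0 := by
      rw [sub_smul, h2, one_smul, sub_self]
    rcases mul_self_eq_one_iff.mp (sub_eq_zero.mp ((smul_eq_zero.mp h3).resolve_right hone)) with
      h4 | h4 <;> simp [h1, h4]
  generalize pauliString p = A at *
  generalize pauliString r = B at *
  generalize hq : pauliString q = X at *
  have e : (A + B) * X * (A + B) = (A * X) * A + (A * X) * B + (B * X) * A + (B * X) * B := by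
    noncomm_ring
  have hBA : B * A = -(A * B) := by rw [hAB, neg_neg]
  have ha : X * A * A = X := by rw [mul_assoc, hA, mul_one]
  have hb : X * B * B = X := by rw [mul_assoc, hB, mul_one]
  have hab : X * A * B = X * (A * B) := mul_assoc _ _ _
  have hba : X * B * A = -(X * (A * B)) := by rw [mul_assoc, hBA, mul_neg]
  rw [e]
  rcases stringSign_eq_or p q with hp | hp <;> rcases stringSign_eq_or r q with hr | hr <;>
    rw [hp] at hXA <;> rw [hr] at hXB <;>
    simp only [Int.cast_one, Int.cast_neg, one_smul, neg_smul] at hXA hXB <;>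
    rw [hXA, hXB] <;> simp only [neg_mul, ha, hb, hab, hba, neg_neg]
  · exact ⟨q, Or.inl (by
      rw [hq]; refine Eq.trans ?_ (half_smul_add_self X); congr 1; abel)⟩
  · have h2 : X * (A * B) * (X * (A * B)) = 1 := by
      calc X * (A * B) * (X * (A * B)) = X * (A * (B * X)) * (A * B) := by noncomm_ring
        _ = -(X * (A * X) * B * (A * B)) := by rw [hXB]; noncomm_ring
        _ = -((X * X) * A * (B * A) * B) := by rw [hXA]; noncomm_ring
        _ = (A * A) * (B * B) := by rw [hX, hBA]; noncomm_ring
        _ = 1 := by rw [hA, hB, mul_one]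
    refine ⟨t, ?_⟩
    -- The goal contains the product as half of its double, so the facts about it are put into that
    -- shape.
    rw [← half_smul_add_self (X * (A * B))] at h2 hz
    have h3 := hzz _ hz h2
    convert h3 using 3 <;> abel
  · have h2 : X * (A * B) * (X * (A * B)) = 1 := by
      calc X * (A * B) * (X * (A * B)) = X * (A * (B * X)) * (A * B) := by noncomm_ring
        _ = X * (A * X) * B * (A * B) := by rw [hXB]; noncomm_ring
        _ = -((X * X) * A * (B * A) * B) := by rw [hXA]; noncomm_ring
        _ = (A * A) * (B * B) := by rw [hX, hBA]; noncomm_ring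
        _ = 1 := by rw [hA, hB, mul_one]
    refine ⟨t, ?_⟩
    rw [← half_smul_add_self (X * (A * B))] at h2 hz
    have h3 := hzz _ hz h2
    have h4 : (1 / 2 : ℂ) • (-X + -(X * (A * B)) + -(X * (A * B)) + X) =
        -((1 / 2 : ℂ) • (X * (A * B) + X * (A * B))) := by
      rw [← smul_neg]; congr 1; abel
    rcases h3 with h3 | h3
    · exact Or.inr (by rw [h4, h3])
    · exact Or.inl (by rw [h4, h3, neg_neg])
  · refine ⟨q, Or.inr ?_⟩
    rw [hq]
    conv_rhs => rw [← half_smul_add_self X, ← smul_neg]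
    congr 1
    abel

/-! The sums over the Clifford group of `tr (S Φ(A) T Φ(B))`. -/

/-- The sum over the Clifford group of `tr (S Φ(A) T Φ(B))`. -/
def cliffordSum (A B S T : Matrix (Qubits Q) (Qubits Q) ℂ) : ℂ :=
  ∑ Φ : cliffordGroup Q, (S * (Φ : Superop (Qubits Q)) A * T * (Φ : Superop (Qubits Q)) B).trace

/-- Replacing $\Phi$ by $h\Phi$ conjugates all four factors by $h$, which the trace does not see.
This is the only symmetry that the twirl uses. -/
theorem cliffordSum_conj {h : unitaryGroup (Qubits Q) ℂ} (hh : IsClifford h)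
    (A B S T : Matrix (Qubits Q) (Qubits Q) ℂ) :
    cliffordSum A B (unitaryChannel h S) (unitaryChannel h T) = cliffordSum A B S T := by
  unfold cliffordSum
  rw [sum_cliffordGroup_comp hh fun Φ => (unitaryChannel h S * Φ A * unitaryChannel h T *
    Φ B).trace]
  refine Finset.sum_congr rfl fun Φ _ => ?_
  simp only [LinearMap.comp_apply, unitaryChannel_mul_apply, trace_unitaryChannel]

theorem cliffordSum_smul_smul (A B S T : Matrix (Qubits Q) (Qubits Q) ℂ) (s t : ℂ) :
    cliffordSum A B (s • S) (t • T) = s * t * cliffordSum A B S T := by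
  simp [cliffordSum, Finset.mul_sum, mul_assoc, mul_left_comm]

/-- Conjugation by a string that commutes with exactly one of the two shows that the sum equals its
own negative. -/
theorem cliffordSum_pauliString_of_ne (A B : Matrix (Qubits Q) (Qubits Q) ℂ)
    {p q : Fin Q → Fin 4} (h : p ≠ q) :
    cliffordSum A B (pauliString p) (pauliString q) = 0 := by
  obtain ⟨r, hr⟩ := exists_stringSign_ne h
  have := cliffordSum_conj (isClifford_pauliUnitary r) A B (pauliString p) (pauliString q)
  rw [pauliUnitary_channel, pauliUnitary_channel, cliffordSum_smul_smul] at this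
  have h1 : stringSign r p * stringSign r q = -1 := by
    rcases stringSign_eq_or r p with h1 | h1 <;> rcases stringSign_eq_or r q with h2 | h2 <;>
      simp_all
  rw [← Int.cast_mul, h1] at this
  push_cast at this
  linear_combination (-1 / 2 : ℂ) * this

theorem cliffordSum_pauliString_eq_of_neg (A B : Matrix (Qubits Q) (Qubits Q) ℂ)
    {p r : Fin Q → Fin 4} (h : stringSign p r = -1) :
    cliffordSum A B (pauliString p) (pauliString p) =
      cliffordSum A B (pauliString r) (pauliString r) := by
  have := cliffordSum_conj (isClifford_swapUnitary p r h) A B (pauliString p) (pauliString p)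
  rw [swapUnitary_channel_left] at this
  exact this.symm

theorem cliffordSum_pauliString_eq (A B : Matrix (Qubits Q) (Qubits Q) ℂ)
    {p q : Fin Q → Fin 4} (hp : p ≠ 0) (hq : q ≠ 0) :
    cliffordSum A B (pauliString p) (pauliString p) =
      cliffordSum A B (pauliString q) (pauliString q) := by
  obtain ⟨r, h1, h2⟩ := exists_stringSign_neg hp hq
  rw [cliffordSum_pauliString_eq_of_neg A B h1, cliffordSum_pauliString_eq_of_neg A B h2]

theorem trace_mem_cliffordGroup (Φ : cliffordGroup Q) (A : Matrix (Qubits Q) (Qubits Q) ℂ) :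
    ((Φ : Superop (Qubits Q)) A).trace = A.trace := by
  obtain ⟨_, U, -, rfl⟩ := Φ
  exact trace_unitaryChannel U A

theorem trace_mul_mem_cliffordGroup (Φ : cliffordGroup Q)
    (A B : Matrix (Qubits Q) (Qubits Q) ℂ) :
    ((Φ : Superop (Qubits Q)) A * (Φ : Superop (Qubits Q)) B).trace = (A * B).trace := by
  obtain ⟨_, U, -, rfl⟩ := Φ
  exact trace_unitaryChannel_mul U A B

theorem cliffordSum_one (A B : Matrix (Qubits Q) (Qubits Q) ℂ) :
    cliffordSum A B 1 1 = (cliffordGroup Q).ncard * (A * B).trace := by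
  simp only [cliffordSum, one_mul, mul_one, trace_mul_mem_cliffordGroup, Finset.sum_const,
    nsmul_eq_mul, Finset.card_univ, ← Nat.card_coe_set_eq, Nat.card_eq_fintype_card]

theorem sum_cliffordSum_pauliString (A B : Matrix (Qubits Q) (Qubits Q) ℂ) :
    ∑ p : Fin Q → Fin 4, cliffordSum A B (pauliString p) (pauliString p) =
      (cliffordGroup Q).ncard * (2 ^ Q * (A.trace * B.trace)) := by
  unfold cliffordSum
  rw [Finset.sum_comm]
  have h : ∀ Φ : cliffordGroup Q, ∑ p : Fin Q → Fin 4, (pauliString p *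
      (Φ : Superop (Qubits Q)) A * pauliString p * (Φ : Superop (Qubits Q)) B).trace =
      2 ^ Q * (A.trace * B.trace) := by
    intro Φ
    rw [← Matrix.trace_sum, ← Finset.sum_mul, sum_pauliString_conj, Matrix.smul_mul,
      Matrix.one_mul, Matrix.trace_smul, trace_mem_cliffordGroup, trace_mem_cliffordGroup,
      smul_eq_mul, mul_assoc]
  simp only [h, Finset.sum_const, nsmul_eq_mul, Finset.card_univ, ← Nat.card_coe_set_eq,
    Nat.card_eq_fintype_card]

/-- The $d^2-1$ nontrivial strings contribute equally. Their total is the sum over all strings,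
known by completeness, minus the trivial term, known because conjugation preserves
$\mathrm{tr}(AB)$. -/
theorem sub_one_mul_cliffordSum_pauliString (A B : Matrix (Qubits Q) (Qubits Q) ℂ)
    {p : Fin Q → Fin 4} (hp : p ≠ 0) :
    ((2 ^ Q) ^ 2 - 1) * cliffordSum A B (pauliString p) (pauliString p) =
      (cliffordGroup Q).ncard * (2 ^ Q * (A.trace * B.trace) - (A * B).trace) := by
  have h1 := sum_cliffordSum_pauliString A B
  rw [← Finset.add_sum_erase _ _ (Finset.mem_univ 0), pauliString_zero, cliffordSum_one,
    Finset.sum_congr rfl fun q hq =>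
      cliffordSum_pauliString_eq A B (Finset.ne_of_mem_erase hq) hp,
    Finset.sum_const, Finset.card_erase_of_mem (Finset.mem_univ _), nsmul_eq_mul,
    Nat.cast_sub (Finset.card_pos.mpr ⟨0, Finset.mem_univ _⟩)] at h1
  have h2 : ((Finset.univ : Finset (Fin Q → Fin 4)).card : ℂ) = (2 ^ Q) ^ 2 := by
    rw [← pow_mul, mul_comm, pow_mul]
    norm_num [Finset.card_univ]
  rw [h2] at h1
  push_cast at h1
  linear_combination h1

end Clifford

/-! ### Kraus representations -/

section Kraus

variable {n : Type} [Fintype n] [DecidableEq n]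

/-- `K` is a family of Kraus operators of `Φ`. -/
structure IsKrausFamily (Φ : Superop n) {L : Type} [Fintype L] (K : L → Matrix n n ℂ) : Prop where
  apply : ∀ X, Φ X = ∑ l, K l * X * (K l)ᴴ
  sum_eq_one : ∑ l, (K l)ᴴ * K l = 1

/-- `Φ` has a Kraus representation. -/
def HasKraus (Φ : Superop n) : Prop :=
  ∃ (L : Type) (_ : Fintype L) (K : L → Matrix n n ℂ), IsKrausFamily Φ K

theorem HasKraus.unitaryChannel (U : unitaryGroup n ℂ) : HasKraus (unitaryChannel U) :=
  ⟨Unit, inferInstance, fun _ => U, by simp [unitaryChannel_apply],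
    by simp [unitary_conjTranspose_mul_self]⟩

theorem HasKraus.id : HasKraus (LinearMap.id : Superop n) := by
  rw [← unitaryChannel_one]; exact HasKraus.unitaryChannel 1

theorem HasKraus.comp {Φ Ψ : Superop n} (hΦ : HasKraus Φ) (hΨ : HasKraus Ψ) :
    HasKraus (Φ ∘ₗ Ψ) := by
  obtain ⟨L, _, K, hK, hK1⟩ := hΦ
  obtain ⟨M, _, J, hJ, hJ1⟩ := hΨ
  refine ⟨L × M, inferInstance, fun x => K x.1 * J x.2, fun X => ?_, ?_⟩
  · simp only [LinearMap.comp_apply, hJ, hK, Fintype.sum_prod_type,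
      Matrix.conjTranspose_mul, Finset.sum_mul, Finset.mul_sum, Matrix.mul_assoc]
  · simp only [Matrix.conjTranspose_mul, Fintype.sum_prod_type]
    rw [Finset.sum_comm]
    have h : ∀ m, ∑ l, (J m)ᴴ * (K l)ᴴ * (K l * J m) = (J m)ᴴ * J m := fun m => by
      calc _ = (J m)ᴴ * (∑ l, (K l)ᴴ * K l) * J m := by
            simp only [Finset.mul_sum, Finset.sum_mul, Matrix.mul_assoc]
        _ = _ := by rw [hK1, Matrix.mul_one]
    simp only [h, hJ1]

theorem HasKraus.trace {Φ : Superop n} (hΦ : HasKraus Φ) (X : Matrix n n ℂ) :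
    (Φ X).trace = X.trace := by
  obtain ⟨L, _, K, hK, hK1⟩ := hΦ
  have h : ∀ l, (K l * X * (K l)ᴴ).trace = ((K l)ᴴ * K l * X).trace := fun l => by
    rw [Matrix.trace_mul_comm, Matrix.mul_assoc]
  rw [hK, Matrix.trace_sum]
  simp only [h]
  rw [← Matrix.trace_sum, ← Finset.sum_mul, hK1, Matrix.one_mul]

open scoped MatrixOrder Matrix.Norms.L2Operator in
theorem _root_.Matrix.PosSemidef.exists_eq_conjTranspose_mul_self {A : Matrix n n ℂ}
    (hA : A.PosSemidef) : ∃ B : Matrix n n ℂ, A = Bᴴ * B := by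
  simpa [Matrix.star_eq_conjTranspose] using
    CStarAlgebra.nonneg_iff_eq_star_mul_self.mp (Matrix.nonneg_iff_posSemidef.mpr hA)

theorem matrix_eq_sum_single (X : Matrix n n ℂ) :
    X = ∑ c, ∑ d, X c d • Matrix.single c d (1 : ℂ) := by
  conv_lhs => rw [Matrix.matrix_eq_sum_single X]
  simp

/-- Choi's theorem. -/
theorem IsChannel.hasKraus {r : ℕ} {Φ : Superop (Fin r)} (hΦ : IsChannel Φ) : HasKraus Φ := by
  -- The unnormalized maximally entangled vector: its projector is sent to the Choi matrix of `Φ`,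
  -- which is positive and so factors as $B^\dagger B$.
  let v : Fin r × Fin r → ℂ := fun x => if x.1 = x.2 then 1 else 0
  obtain ⟨B, hB⟩ := (hΦ.completelyPositive r _
    (posSemidef_vecMulVec_self_star v)).exists_eq_conjTranspose_mul_self
  have hsingle : ∀ a b c d, Φ (Matrix.single c d 1) a b = ∑ l, star (B l (a, c)) * B l (b, d) := by
    intro a b c d
    have h := congrFun (congrFun hB (a, c)) (b, d)
    simp only [Matrix.mul_apply, Matrix.conjTranspose_apply] at h
    have e : Matrix.single c d (1 : ℂ) =
        Matrix.of fun i j => vecMulVec v (star v) (i, c) (j, d) := by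
      ext i j
      simp only [v, vecMulVec_apply, Matrix.of_apply, Pi.star_apply, Matrix.single_apply]
      by_cases h1 : c = i <;> by_cases h2 : d = j <;> simp [h1, h2, eq_comm]
    rw [← h, e]
    rfl
  -- Each row of `B`, conjugated and reshaped into a matrix, is one Kraus operator.
  let K : Fin r × Fin r → Matrix (Fin r) (Fin r) ℂ := fun l => Matrix.of fun a c => star (B l (a, c))
  have hK : ∀ X, Φ X = ∑ l, K l * X * (K l)ᴴ := by
    intro X
    ext a b
    conv_lhs => rw [matrix_eq_sum_single X]
    simp only [map_sum, map_smul, Matrix.sum_apply, Matrix.smul_apply, hsingle, smul_eq_mul,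
      Matrix.mul_apply, Matrix.conjTranspose_apply, Finset.sum_mul, Finset.mul_sum, K,
      Matrix.of_apply, star_star]
    rw [Finset.sum_comm]
    conv_rhs => rw [Finset.sum_comm]
    refine Finset.sum_congr rfl fun d _ => ?_
    rw [Finset.sum_comm]
    exact Finset.sum_congr rfl fun l _ => Finset.sum_congr rfl fun c _ => by ring
  refine ⟨_, inferInstance, K, hK, Matrix.ext_iff_trace_mul_right.mpr fun X => ?_⟩
  have h := hΦ.tracePreserving X
  rw [hK, Matrix.trace_sum] at h
  rw [Matrix.one_mul, ← h, Finset.sum_mul, Matrix.trace_sum]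
  exact Finset.sum_congr rfl fun l _ => by
    rw [Matrix.trace_mul_comm (K l * X), Matrix.mul_assoc]

/-- Expanding a product over qubits of sums over Kraus indices gives a sum over strings of indices.
-/
theorem IsKrausFamily.tensorPower (Q : ℕ) {Φ : Superop (Fin 2)} {L : Type} [Fintype L]
    {K : L → Matrix (Fin 2) (Fin 2) ℂ} (h : IsKrausFamily Φ K) :
    IsKrausFamily (tensorPower Q Φ) fun l : Fin Q → L => tensorMatrix fun i => K (l i) := by
  have hsingle : ∀ a b c d, Φ (Matrix.single c d 1) a b = ∑ l, K l a c * star (K l b d) := by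
    intro a b c d
    rw [h.apply, Matrix.sum_apply]
    refine Finset.sum_congr rfl fun l _ => ?_
    simp [Matrix.mul_apply, Matrix.single_apply, ite_and]
  constructor
  · intro X
    ext a b
    simp only [PingPong.tensorPower, LinearMap.coe_mk, AddHom.coe_mk, Matrix.of_apply, hsingle,
      Matrix.sum_apply, Matrix.mul_apply, Matrix.conjTranspose_apply, tensorMatrix_apply,
      prod_sum_eq_sum_prod, Finset.prod_mul_distrib, star_prod, Finset.sum_mul]
    rw [Finset.sum_comm]
    conv_rhs => rw [Finset.sum_comm]
    refine Finset.sum_congr rfl fun d _ => ?_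
    rw [Finset.sum_comm]
    exact Finset.sum_congr rfl fun l _ => Finset.sum_congr rfl fun c _ => by ring
  · simp only [tensorMatrix_conjTranspose, tensorMatrix_mul]
    rw [← tensorMatrix_one, ← h.sum_eq_one]
    ext a b
    simp only [Matrix.sum_apply, tensorMatrix_apply, prod_sum_eq_sum_prod]

theorem HasKraus.tensorPower (Q : ℕ) {Φ : Superop (Fin 2)} (h : HasKraus Φ) :
    HasKraus (tensorPower Q Φ) := by
  obtain ⟨L, _, K, hK⟩ := h
  exact ⟨_, inferInstance, _, hK.tensorPower Q⟩

/-- The tensor power of a unitary. -/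
def tensorUnitary (Q : ℕ) (u : unitaryGroup (Fin 2) ℂ) : unitaryGroup (Qubits Q) ℂ :=
  ⟨tensorMatrix fun _ => u, by
    rw [Matrix.mem_unitaryGroup_iff, Matrix.star_eq_conjTranspose, tensorMatrix_conjTranspose,
      tensorMatrix_mul]
    simp only [unitary_mul_conjTranspose_self, tensorMatrix_one]⟩

theorem tensorPower_unitaryChannel (Q : ℕ) (u : unitaryGroup (Fin 2) ℂ) :
    tensorPower Q (unitaryChannel u) = unitaryChannel (tensorUnitary Q u) := by
  have h : IsKrausFamily (unitaryChannel u) fun _ : Unit => (u : Matrix (Fin 2) (Fin 2) ℂ) :=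
    ⟨by simp [unitaryChannel_apply], by simp [unitary_conjTranspose_mul_self]⟩
  ext1 X
  rw [(h.tensorPower Q).apply]
  simp [unitaryChannel_apply, tensorUnitary]

/-! ### Entanglement fidelity and the depolarizing parameter -/

/-- The entanglement fidelity `⟨Ω|(Φ ⊗ id)(|Ω⟩⟨Ω|)|Ω⟩` for the maximally entangled `Ω`. -/
def entanglementFidelity (Φ : Superop n) : ℝ :=
  (((Fintype.card n : ℝ)) ^ 2)⁻¹ * (∑ a, ∑ b, Φ (Matrix.single a b 1) a b).re

/-- Since $\Phi(E_{ab})_{ab}=\sum_l (K_l)_{aa}\overline{(K_l)_{bb}}$, summing over $a,b$ yields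
$|\mathrm{tr}\,K_l|^2$. -/
theorem IsKrausFamily.entanglementFidelity_eq {Φ : Superop n} {L : Type} [Fintype L]
    {K : L → Matrix n n ℂ} (h : IsKrausFamily Φ K) :
    entanglementFidelity Φ = ((Fintype.card n : ℝ) ^ 2)⁻¹ * ∑ l, ‖(K l).trace‖ ^ 2 := by
  have h1 : ∑ a, ∑ b, Φ (Matrix.single a b 1) a b =
      ((∑ l, ‖(K l).trace‖ ^ 2 : ℝ) : ℂ) := by
    have h2 : ∀ a b, Φ (Matrix.single a b 1) a b = ∑ l, K l a a * star (K l b b) := by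
      intro a b
      rw [h.apply, Matrix.sum_apply]
      refine Finset.sum_congr rfl fun l _ => ?_
      simp [Matrix.mul_apply, Matrix.single_apply, ite_and]
    simp only [h2]
    push_cast
    calc ∑ a, ∑ b, ∑ l, K l a a * star (K l b b) = ∑ l, ∑ a, ∑ b, K l a a * star (K l b b) := by
          rw [Finset.sum_comm_cycle]
      _ = _ := by
          refine Finset.sum_congr rfl fun l _ => ?_
          rw [← Complex.mul_conj', Matrix.trace, map_sum, Finset.sum_mul_sum]
          rfl
  rw [entanglementFidelity, h1, Complex.ofReal_re]

theorem IsKrausFamily.sum_trace {Φ : Superop n} {L : Type} [Fintype L]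
    {K : L → Matrix n n ℂ} (h : IsKrausFamily Φ K) :
    ∑ l, ((K l)ᴴ * K l).trace = Fintype.card n := by
  rw [← Matrix.trace_sum, h.sum_eq_one, Matrix.trace_one]

end Kraus

/-! ### The Clifford twirl of a channel is depolarizing -/

section Twirl

variable {Q : ℕ}

/-- The coefficient of a Pauli string in the expansion of a matrix. -/
def pauliCoeff (K : Matrix (Qubits Q) (Qubits Q) ℂ) (p : Fin Q → Fin 4) : ℂ :=
  ((2 : ℂ) ^ Q)⁻¹ * (pauliString p * K).trace

theorem pauliCoeff_zero (K : Matrix (Qubits Q) (Qubits Q) ℂ) :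
    pauliCoeff K 0 = ((2 : ℂ) ^ Q)⁻¹ * K.trace := by
  rw [pauliCoeff, pauliString_zero, Matrix.one_mul]

theorem star_pauliCoeff (K : Matrix (Qubits Q) (Qubits Q) ℂ) (p : Fin Q → Fin 4) :
    star (pauliCoeff K p) = ((2 : ℂ) ^ Q)⁻¹ * (Kᴴ * pauliString p).trace := by
  rw [pauliCoeff, star_mul', ← Matrix.trace_conjTranspose, Matrix.conjTranspose_mul,
    pauliString_conjTranspose]
  simp

/-- Parseval's identity for the basis of Pauli strings. -/
theorem sum_pauliCoeff_mul_star (K : Matrix (Qubits Q) (Qubits Q) ℂ) :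
    ∑ p : Fin Q → Fin 4, pauliCoeff K p * star (pauliCoeff K p) =
      ((2 : ℂ) ^ Q)⁻¹ * (Kᴴ * K).trace := by
  have h := congrArg (fun Z => (Kᴴ * Z).trace) (pauliString_expansion K)
  simp only [Finset.mul_sum, Matrix.trace_sum, Matrix.mul_smul, Matrix.trace_smul,
    smul_eq_mul] at h
  rw [h, Finset.mul_sum]
  refine Finset.sum_congr rfl fun p _ => ?_
  rw [star_pauliCoeff, pauliCoeff]
  ring

theorem trace_kraus_expansion (K X Y : Matrix (Qubits Q) (Qubits Q) ℂ) :
    (K * X * Kᴴ * Y).trace = ∑ p : Fin Q → Fin 4, ∑ q : Fin Q → Fin 4,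
      pauliCoeff K p * star (pauliCoeff K q) *
      (pauliString p * X * pauliString q * Y).trace := by
  have h1 : K = ∑ p : Fin Q → Fin 4, pauliCoeff K p • pauliString p := pauliString_expansion K
  have h2 : Kᴴ = ∑ p : Fin Q → Fin 4, star (pauliCoeff K p) • pauliString p := by
    conv_lhs => rw [h1]
    simp only [Matrix.conjTranspose_sum, Matrix.conjTranspose_smul, pauliString_conjTranspose]
  generalize pauliCoeff K = c at h1 h2 ⊢
  rw [h2, h1]
  simp only [Finset.sum_mul, Finset.mul_sum, Matrix.trace_sum, Matrix.smul_mul, Matrix.mul_smul,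
    Matrix.trace_smul, smul_eq_mul]
  rw [Finset.sum_comm]
  exact Finset.sum_congr rfl fun p _ => Finset.sum_congr rfl fun q _ => by ring

theorem cliffordSum_conjTranspose (A B K : Matrix (Qubits Q) (Qubits Q) ℂ) :
    cliffordSum A B K Kᴴ = ∑ p : Fin Q → Fin 4, pauliCoeff K p * star (pauliCoeff K p) *
      cliffordSum A B (pauliString p) (pauliString p) := by
  have h : cliffordSum A B K Kᴴ = ∑ p : Fin Q → Fin 4, ∑ q : Fin Q → Fin 4,
      pauliCoeff K p * star (pauliCoeff K q) *
        cliffordSum A B (pauliString p) (pauliString q) := by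
    unfold cliffordSum
    simp only [trace_kraus_expansion, Finset.mul_sum]
    rw [Finset.sum_comm]
    refine Finset.sum_congr rfl fun p _ => ?_
    rw [Finset.sum_comm]
  rw [h]
  refine Finset.sum_congr rfl fun p _ => ?_
  rw [Finset.sum_eq_single p]
  · intro q _ hq
    rw [cliffordSum_pauliString_of_ne A B hq.symm, mul_zero]
  · simp

/-- Only the weight of the trivial string and the total weight of the Kraus operator matter, because
all nontrivial strings have the same Clifford sum. -/
theorem sub_one_mul_cliffordSum_conjTranspose (A B K : Matrix (Qubits Q) (Qubits Q) ℂ) :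
    ((2 ^ Q) ^ 2 - 1) * cliffordSum A B K Kᴴ = (cliffordGroup Q).ncard *
      (pauliCoeff K 0 * star (pauliCoeff K 0) *
          ((2 ^ Q) ^ 2 * (A * B).trace - 2 ^ Q * (A.trace * B.trace)) +
        ((2 : ℂ) ^ Q)⁻¹ * (Kᴴ * K).trace * (2 ^ Q * (A.trace * B.trace) - (A * B).trace)) := by
  rw [cliffordSum_conjTranspose, ← sum_pauliCoeff_mul_star,
    ← Finset.add_sum_erase _ _ (Finset.mem_univ 0), pauliString_zero, cliffordSum_one,
    ← Finset.add_sum_erase _ (fun p => pauliCoeff K p * star (pauliCoeff K p))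
      (Finset.mem_univ 0), mul_add, Finset.mul_sum]
  have h : ∀ p ∈ Finset.univ.erase (0 : Fin Q → Fin 4),
      ((2 ^ Q) ^ 2 - 1) * (pauliCoeff K p * star (pauliCoeff K p) *
        cliffordSum A B (pauliString p) (pauliString p)) =
      pauliCoeff K p * star (pauliCoeff K p) *
        ((cliffordGroup Q).ncard * (2 ^ Q * (A.trace * B.trace) - (A * B).trace)) := by
    intro p hp
    rw [← sub_one_mul_cliffordSum_pauliString A B (Finset.ne_of_mem_erase hp)]
    ring
  rw [Finset.sum_congr rfl h, ← Finset.sum_mul]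
  ring

/-- The parameter `p` of the depolarizing channel obtained by twirling `Φ`. -/
def depolarizingParam (Φ : Superop (Qubits Q)) : ℝ :=
  ((2 ^ Q) ^ 2 * entanglementFidelity Φ - 1) / ((2 ^ Q) ^ 2 - 1)

/-- The bilinear form `tr (D_p(A) B)` of the depolarizing channel `D_p`. -/
def depolarizingForm (p : ℝ) (A B : Matrix (Qubits Q) (Qubits Q) ℂ) : ℂ :=
  p * (A * B).trace + (1 - p) * (2 ^ Q)⁻¹ * (A.trace * B.trace)

/-- The average over the Clifford group turns every channel into a depolarizing channel. -/
theorem clifford_twirl (hQ : Q ≠ 0) {Λ : Superop (Qubits Q)} (hΛ : HasKraus Λ)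
    (A B : Matrix (Qubits Q) (Qubits Q) ℂ) :
    ∑ Φ : cliffordGroup Q, (Λ ((Φ : Superop (Qubits Q)) A) * (Φ : Superop (Qubits Q)) B).trace =
      (cliffordGroup Q).ncard * depolarizingForm (depolarizingParam Λ) A B := by
  obtain ⟨L, _, K, hK⟩ := hΛ
  have h1 : ∑ Φ : cliffordGroup Q, (Λ ((Φ : Superop (Qubits Q)) A) *
      (Φ : Superop (Qubits Q)) B).trace = ∑ l, cliffordSum A B (K l) (K l)ᴴ := by
    unfold cliffordSum
    rw [Finset.sum_comm]
    refine Finset.sum_congr rfl fun Φ _ => ?_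
    rw [hK.apply, Finset.sum_mul, Matrix.trace_sum]
  -- Trace preservation makes the total Pauli weight equal to 1; the weight on the trivial string is
  -- the entanglement fidelity.
  have h2 : ∑ l, ((2 : ℂ) ^ Q)⁻¹ * ((K l)ᴴ * K l).trace = 1 := by
    rw [← Finset.mul_sum, hK.sum_trace]
    simp
  have h3 : ∑ l, pauliCoeff (K l) 0 * star (pauliCoeff (K l) 0) =
      (entanglementFidelity Λ : ℂ) := by
    rw [hK.entanglementFidelity_eq]
    push_cast
    rw [Finset.mul_sum]
    refine Finset.sum_congr rfl fun l _ => ?_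
    rw [RCLike.star_def, Complex.mul_conj', pauliCoeff_zero]
    simp [mul_pow]
  -- This is where at least one qubit is required: for $d=1$ the depolarizing parameter is
  -- meaningless.
  have hd : ((2 ^ Q) ^ 2 - 1 : ℂ) ≠ 0 := by
    have h : (1 : ℝ) < 2 ^ Q := one_lt_pow₀ (by norm_num) hQ
    have h' : ((2 ^ Q) ^ 2 - 1 : ℝ) ≠ 0 := by nlinarith
    exact_mod_cast h'
  have h4 : ((2 ^ Q) ^ 2 - 1 : ℂ) * ∑ l, cliffordSum A B (K l) (K l)ᴴ =
      (cliffordGroup Q).ncard * (entanglementFidelity Λ *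
          ((2 ^ Q) ^ 2 * (A * B).trace - 2 ^ Q * (A.trace * B.trace)) +
        (2 ^ Q * (A.trace * B.trace) - (A * B).trace)) := by
    rw [Finset.mul_sum, Finset.sum_congr rfl fun l _ =>
      sub_one_mul_cliffordSum_conjTranspose A B (K l), ← Finset.mul_sum, Finset.sum_add_distrib,
      ← Finset.sum_mul, ← Finset.sum_mul, h2, h3, one_mul]
  rw [h1]
  refine mul_left_cancel₀ hd (h4.trans ?_)
  have h2Q : (2 : ℂ) ^ Q ≠ 0 := by positivity
  rw [depolarizingForm, depolarizingParam]
  push_cast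
  field_simp
  ring

end Twirl

/-! ### Trace norm and operator norm -/

section TraceNorm

open scoped Matrix.Norms.L2Operator

variable {n : Type} [Fintype n] [DecidableEq n]

theorem l2_opNorm_one_le : ‖(1 : Matrix n n ℂ)‖ ≤ 1 := by
  rw [← Matrix.diagonal_one, Matrix.l2_opNorm_diagonal]
  exact (pi_norm_le_iff_of_nonneg zero_le_one).mpr fun i => by simp

theorem l2_opNorm_unitary_le {U : Matrix n n ℂ} (hU : Uᴴ * U = 1) : ‖U‖ ≤ 1 := by
  have h := Matrix.l2_opNorm_conjTranspose_mul_self U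
  rw [hU] at h
  have := l2_opNorm_one_le (n := n)
  nlinarith [norm_nonneg U]

theorem norm_apply_le_l2_opNorm (A : Matrix n n ℂ) (i j : n) : ‖A i j‖ ≤ ‖A‖ := by
  have h := Matrix.l2_opNorm_mulVec A (EuclideanSpace.single j 1)
  have h2 := PiLp.norm_apply_le (p := 2)
    ((EuclideanSpace.equiv n ℂ).symm (A *ᵥ (EuclideanSpace.single j (1 : ℂ)).ofLp)) i
  refine le_trans ?_ (h2.trans (h.trans ?_))
  · simp
  · simp

theorem _root_.Matrix.IsHermitian.eq_mul_diagonal_mul {A : Matrix n n ℂ} (hA : A.IsHermitian) :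
    A = (hA.eigenvectorUnitary : Matrix n n ℂ) *
      diagonal (fun i => (hA.eigenvalues i : ℂ)) * (hA.eigenvectorUnitary : Matrix n n ℂ)ᴴ := by
  have h := hA.spectral_theorem
  rwa [Unitary.conjStarAlgAut_apply] at h

/-- In an eigenbasis of `ρ` the trace is a combination of diagonal entries of `W`, each at most the
operator norm, with the eigenvalues as nonnegative weights. -/
theorem norm_trace_mul_le (W : Matrix n n ℂ) {ρ : Matrix n n ℂ} (hρ : ρ.PosSemidef) :
    ‖(W * ρ).trace‖ ≤ ‖W‖ * ρ.trace.re := by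
  set V : Matrix n n ℂ := (hρ.1.eigenvectorUnitary : Matrix n n ℂ) with hV
  have hVV : Vᴴ * V = 1 := unitary_conjTranspose_mul_self _
  have hn : ‖Vᴴ * W * V‖ ≤ ‖W‖ := by
    have h1 := l2_opNorm_unitary_le hVV
    have h2 : ‖Vᴴ‖ ≤ 1 := by rwa [Matrix.l2_opNorm_conjTranspose]
    calc ‖Vᴴ * W * V‖ ≤ ‖Vᴴ‖ * ‖W‖ * ‖V‖ :=
          (Matrix.l2_opNorm_mul _ _).trans
            (mul_le_mul_of_nonneg_right (Matrix.l2_opNorm_mul _ _) (norm_nonneg _))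
      _ ≤ 1 * ‖W‖ * 1 := by gcongr
      _ = ‖W‖ := by ring
  have h1 : (W * ρ).trace = ∑ i, (Vᴴ * W * V) i i * (hρ.1.eigenvalues i : ℂ) := by
    conv_lhs => rw [hρ.1.eq_mul_diagonal_mul]
    rw [← hV, ← Matrix.mul_assoc, ← Matrix.mul_assoc, Matrix.trace_mul_comm, ← Matrix.mul_assoc,
      ← Matrix.mul_assoc]
    simp [Matrix.trace, Matrix.mul_diagonal]
  have h2 : ρ.trace.re = ∑ i, hρ.1.eigenvalues i := by
    rw [hρ.1.trace_eq_sum_eigenvalues]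
    simp
  rw [h1, h2, Finset.mul_sum]
  refine (norm_sum_le _ _).trans (Finset.sum_le_sum fun i _ => ?_)
  rw [norm_mul, Complex.norm_real, Real.norm_of_nonneg (hρ.eigenvalues_nonneg i)]
  exact mul_le_mul_of_nonneg_right ((norm_apply_le_l2_opNorm _ i i).trans hn)
    (hρ.eigenvalues_nonneg i)

theorem exists_trace_mul_eq_traceNorm (A : Matrix n n ℂ) :
    ∃ W : Matrix n n ℂ, ‖W‖ ≤ 1 ∧ (W * A).trace = (traceNorm A : ℂ) := by
  have hA := isHermitian_conjTranspose_mul_self A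
  set V : Matrix n n ℂ := (hA.eigenvectorUnitary : Matrix n n ℂ) with hV
  have hVV : Vᴴ * V = 1 := unitary_conjTranspose_mul_self _
  set e := hA.eigenvalues with he
  have he0 : ∀ i, 0 ≤ e i := fun i => (posSemidef_conjTranspose_mul_self A).eigenvalues_nonneg i
  have hdec : Aᴴ * A = V * diagonal (fun i => (e i : ℂ)) * Vᴴ := hA.eq_mul_diagonal_mul
  -- `T` is the pseudo-inverse of $|A|=\sqrt{A^\dagger A}$; the convention `0⁻¹ = 0` takes care of
  -- the kernel. The witness $TA^\dagger$ is then the adjoint of the partial isometry in the polar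
  -- decomposition of `A`.
  let T : Matrix n n ℂ := V * diagonal (fun i => (((√(e i))⁻¹ : ℝ) : ℂ)) * Vᴴ
  have hT : Tᴴ = T := by
    simp [T, Matrix.conjTranspose_mul, Matrix.diagonal_conjTranspose, Matrix.mul_assoc,
      Pi.star_def]
  have hmul : ∀ f g : n → ℂ, (V * diagonal f * Vᴴ) * (V * diagonal g * Vᴴ) =
      V * diagonal (fun i => f i * g i) * Vᴴ := by
    intro f g
    calc _ = V * diagonal f * (Vᴴ * V) * diagonal g * Vᴴ := by simp only [Matrix.mul_assoc]
      _ = _ := by rw [hVV, Matrix.mul_one, Matrix.mul_assoc V, Matrix.diagonal_mul_diagonal]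
  refine ⟨T * Aᴴ, ?_, ?_⟩
  · have h1 : ‖T * Aᴴ‖ * ‖T * Aᴴ‖ ≤ 1 := by
      have h2 := Matrix.l2_opNorm_conjTranspose_mul_self (T * Aᴴ)ᴴ
      rw [Matrix.l2_opNorm_conjTranspose] at h2
      rw [← h2, Matrix.conjTranspose_conjTranspose, Matrix.conjTranspose_mul,
        Matrix.conjTranspose_conjTranspose, hT]
      have h3 : T * Aᴴ * (A * T) = V * diagonal (fun i => (((√(e i))⁻¹ : ℝ) : ℂ) *
          (e i : ℂ) * (((√(e i))⁻¹ : ℝ) : ℂ)) * Vᴴ := by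
        rw [← hmul, ← hmul, ← hdec]
        simp only [T, Matrix.mul_assoc]
      rw [h3]
      have hd : ‖diagonal (fun i => (((√(e i))⁻¹ : ℝ) : ℂ) * (e i : ℂ) *
          (((√(e i))⁻¹ : ℝ) : ℂ))‖ ≤ 1 := by
        rw [Matrix.l2_opNorm_diagonal]
        refine (pi_norm_le_iff_of_nonneg zero_le_one).mpr fun i => ?_
        rw [← Complex.ofReal_mul, ← Complex.ofReal_mul, Complex.norm_real, mul_right_comm,
          ← mul_inv, Real.mul_self_sqrt (he0 i)]
        rcases (he0 i).eq_or_lt with h | h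
        · simp [← h]
        · rw [inv_mul_cancel₀ h.ne']; simp
      have hv := l2_opNorm_unitary_le hVV
      have hv' : ‖Vᴴ‖ ≤ 1 := by rwa [Matrix.l2_opNorm_conjTranspose]
      calc _ ≤ _ := (Matrix.l2_opNorm_mul _ _).trans
            (mul_le_mul_of_nonneg_right (Matrix.l2_opNorm_mul _ _) (norm_nonneg _))
        _ ≤ 1 * 1 * 1 := by gcongr
        _ = 1 := by norm_num
    nlinarith [norm_nonneg (T * Aᴴ)]
  · rw [Matrix.mul_assoc, hdec, hmul, Matrix.trace_mul_comm, ← Matrix.mul_assoc, hVV,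
      Matrix.one_mul, Matrix.trace_diagonal, traceNorm]
    push_cast
    refine Finset.sum_congr rfl fun i _ => ?_
    rw [← Complex.ofReal_inv, ← Complex.ofReal_mul]
    congr 1
    rw [← he]
    rcases (he0 i).eq_or_lt with h | h
    · simp [← h]
    · nth_rewrite 2 [← Real.mul_self_sqrt (he0 i)]
      rw [← mul_assoc, inv_mul_cancel₀ (Real.sqrt_pos.mpr h).ne', one_mul]

/-- By duality, trace norm estimates reduce to estimates of $|\mathrm{tr}(WA)|$ for contractions
$W$, so the triangle inequality is only needed for complex numbers. -/
theorem traceNorm_le {A : Matrix n n ℂ} {t : ℝ}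
    (h : ∀ W : Matrix n n ℂ, ‖W‖ ≤ 1 → ‖(W * A).trace‖ ≤ t) : traceNorm A ≤ t := by
  obtain ⟨W, hW, hWA⟩ := exists_trace_mul_eq_traceNorm A
  have := h W hW
  rw [hWA, Complex.norm_real] at this
  exact (le_abs_self _).trans this

/-- The squared Frobenius norm. -/
def frobeniusSq (K : Matrix n n ℂ) : ℝ := ∑ a, ∑ b, ‖K a b‖ ^ 2

theorem frobeniusSq_nonneg {m : Type} [Fintype m] (K : Matrix m m ℂ) : 0 ≤ frobeniusSq K := by
  unfold frobeniusSq; positivity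

theorem trace_conjTranspose_mul_self {m : Type} [Fintype m] (K : Matrix m m ℂ) :
    (Kᴴ * K).trace = (frobeniusSq K : ℂ) := by
  simp only [Matrix.trace, Matrix.diag, Matrix.mul_apply, Matrix.conjTranspose_apply,
    frobeniusSq, Complex.ofReal_sum, Complex.ofReal_pow]
  rw [Finset.sum_comm]
  exact Finset.sum_congr rfl fun a _ => Finset.sum_congr rfl fun b _ => Complex.conj_mul' _

/-- Cauchy–Schwarz on each slice of the reference system. The bound does not depend on the dimension
of the reference, as the diamond distance requires. -/
theorem l2_opNorm_kronecker_one_le (m : Type) [Fintype m] [DecidableEq m] (K : Matrix n n ℂ) :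
    ‖K ⊗ₖ (1 : Matrix m m ℂ)‖ ≤ √(frobeniusSq K) := by
  rw [Matrix.l2_opNorm_def]
  refine ContinuousLinearMap.opNorm_le_bound _ (Real.sqrt_nonneg _) fun v => ?_
  refine le_of_sq_le_sq ?_ (by positivity)
  rw [mul_pow, Real.sq_sqrt (frobeniusSq_nonneg K), EuclideanSpace.norm_sq_eq,
    EuclideanSpace.norm_sq_eq]
  have h : ∀ x : n × m, ((K ⊗ₖ (1 : Matrix m m ℂ)) *ᵥ v.ofLp) x = ∑ b, K x.1 b * v (b, x.2) := by
    intro x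
    simp [Matrix.mulVec, dotProduct, Fintype.sum_prod_type, Matrix.kroneckerMap_apply,
      Matrix.one_apply]
  calc ∑ x : n × m, ‖((K ⊗ₖ (1 : Matrix m m ℂ)) *ᵥ v.ofLp) x‖ ^ 2
      ≤ ∑ x : n × m, (∑ b, ‖K x.1 b‖ ^ 2) * ∑ b, ‖v (b, x.2)‖ ^ 2 := by
        refine Finset.sum_le_sum fun x _ => ?_
        rw [h]
        calc _ ≤ (∑ b, ‖K x.1 b‖ * ‖v (b, x.2)‖) ^ 2 := by
              gcongr
              exact (norm_sum_le _ _).trans (by simp)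
          _ ≤ _ := Finset.sum_mul_sq_le_sq_mul_sq _ _ _
    _ = _ := by
        rw [Fintype.sum_prod_type]
        simp only [← Finset.mul_sum, ← Finset.sum_mul, frobeniusSq]
        rw [Fintype.sum_prod_type_right]

end TraceNorm

/-! ### Diamond distance of a protocol to its noisy version -/

section Diamond

open scoped Matrix.Norms.L2Operator

variable {n : Type} [Fintype n] [DecidableEq n]

theorem ampliate_comp (Φ Ψ : Superop n) (m : Type) (X : Matrix (n × m) (n × m) ℂ) :
    ampliate (Φ ∘ₗ Ψ) m X = ampliate Φ m (ampliate Ψ m X) := by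
  ext p q
  simp only [ampliate, Matrix.of_apply, LinearMap.comp_apply]
  rfl

variable {m : Type} [Fintype m] [DecidableEq m]

theorem IsKrausFamily.ampliate {Φ : Superop n} {L : Type} [Fintype L] {K : L → Matrix n n ℂ}
    (h : IsKrausFamily Φ K) (X : Matrix (n × m) (n × m) ℂ) :
    ampliate Φ m X = ∑ l, (K l ⊗ₖ (1 : Matrix m m ℂ)) * X * (K l ⊗ₖ (1 : Matrix m m ℂ))ᴴ := by
  ext p q
  simp only [PingPong.ampliate, Matrix.of_apply, h.apply, Matrix.sum_apply]
  refine Finset.sum_congr rfl fun l _ => ?_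
  simp [Matrix.mul_apply, Fintype.sum_prod_type, Matrix.kroneckerMap_apply, Matrix.one_apply,
    apply_ite]

theorem HasKraus.ampliate_isDensity {Φ : Superop n} (hΦ : HasKraus Φ)
    {ρ : Matrix (n × m) (n × m) ℂ} (hρ : IsDensity ρ) : IsDensity (ampliate Φ m ρ) := by
  constructor
  · obtain ⟨L, _, K, hK⟩ := hΦ
    rw [hK.ampliate]
    exact Matrix.posSemidef_sum _ fun l _ => hρ.1.mul_mul_conjTranspose_same _
  · rw [← hρ.2]
    simp only [Matrix.trace, Matrix.diag, Fintype.sum_prod_type_right, PingPong.ampliate,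
      Matrix.of_apply]
    refine Finset.sum_congr rfl fun s _ => ?_
    exact hΦ.trace (Matrix.of fun a b => ρ (a, s) (b, s))

theorem ampliate_unitaryChannel (U : unitaryGroup n ℂ) (X : Matrix (n × m) (n × m) ℂ) :
    ampliate (unitaryChannel U) m X =
      ((U : Matrix n n ℂ) ⊗ₖ (1 : Matrix m m ℂ)) * X *
        ((U : Matrix n n ℂ) ⊗ₖ (1 : Matrix m m ℂ))ᴴ := by
  have h : IsKrausFamily (unitaryChannel U) fun _ : Unit => (U : Matrix n n ℂ) :=
    ⟨by simp [unitaryChannel_apply], by simp [unitary_conjTranspose_mul_self]⟩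
  rw [h.ampliate]
  simp

/-! ### Channels of high entanglement fidelity are close to the identity -/

theorem frobeniusSq_sub_smul_one [Nonempty n] (K : Matrix n n ℂ) :
    frobeniusSq (K - ((Fintype.card n : ℂ)⁻¹ * K.trace) • 1) =
      frobeniusSq K - (Fintype.card n : ℝ)⁻¹ * ‖K.trace‖ ^ 2 := by
  have hd : (Fintype.card n : ℂ) ≠ 0 := by simp
  have h : ((frobeniusSq (K - ((Fintype.card n : ℂ)⁻¹ * K.trace) • 1) : ℝ) : ℂ) =
      ((frobeniusSq K - (Fintype.card n : ℝ)⁻¹ * ‖K.trace‖ ^ 2 : ℝ) : ℂ) := by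
    push_cast
    rw [← trace_conjTranspose_mul_self, ← trace_conjTranspose_mul_self, ← Complex.mul_conj']
    simp only [Matrix.conjTranspose_sub, Matrix.conjTranspose_smul, Matrix.conjTranspose_one,
      sub_mul, mul_sub, Matrix.trace_sub, Matrix.smul_mul, Matrix.mul_smul, Matrix.one_mul,
      Matrix.mul_one, Matrix.trace_smul, Matrix.trace_one, smul_eq_mul,
      Matrix.trace_conjTranspose, star_mul', RCLike.star_def, map_inv₀, map_natCast]
    field_simp
    ring
  exact_mod_cast h

theorem IsKrausFamily.sum_frobeniusSq {Φ : Superop n} {L : Type} [Fintype L]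
    {K : L → Matrix n n ℂ} (h : IsKrausFamily Φ K) :
    ∑ l, frobeniusSq (K l) = Fintype.card n := by
  have h1 := h.sum_trace
  simp only [trace_conjTranspose_mul_self] at h1
  exact_mod_cast h1

/-- Removing from each Kraus operator its component along the identity leaves, by Pythagoras, total
weight $d-dF$. -/
theorem IsKrausFamily.sum_frobeniusSq_sub [Nonempty n] {Φ : Superop n} {L : Type} [Fintype L]
    {K : L → Matrix n n ℂ} (h : IsKrausFamily Φ K) :
    ∑ l, frobeniusSq (K l - ((Fintype.card n : ℂ)⁻¹ * (K l).trace) • 1) =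
      Fintype.card n * (1 - entanglementFidelity Φ) := by
  have hd : (Fintype.card n : ℝ) ≠ 0 := by simp
  simp only [frobeniusSq_sub_smul_one, Finset.sum_sub_distrib, h.sum_frobeniusSq,
    h.entanglementFidelity_eq, ← Finset.mul_sum]
  field_simp

theorem entanglementFidelity_nonneg {Φ : Superop n} (hΦ : HasKraus Φ) :
    0 ≤ entanglementFidelity Φ := by
  obtain ⟨L, _, K, hK⟩ := hΦ
  rw [hK.entanglementFidelity_eq]
  positivity

theorem entanglementFidelity_le_one [Nonempty n] {Φ : Superop n} (hΦ : HasKraus Φ) :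
    entanglementFidelity Φ ≤ 1 := by
  obtain ⟨L, _, K, hK⟩ := hΦ
  have h := hK.sum_frobeniusSq_sub
  have h1 : 0 ≤ ∑ l, frobeniusSq (K l - ((Fintype.card n : ℂ)⁻¹ * (K l).trace) • 1) :=
    Finset.sum_nonneg fun l _ => frobeniusSq_nonneg _
  rw [h] at h1
  have hd : (0 : ℝ) < Fintype.card n := by exact_mod_cast Fintype.card_pos
  nlinarith [nonneg_of_mul_nonneg_right h1 hd]

theorem norm_trace_mul_le_of_isDensity (W : Matrix n n ℂ) {ρ : Matrix n n ℂ} (hρ : IsDensity ρ) :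
    ‖(W * ρ).trace‖ ≤ ‖W‖ := by
  simpa [hρ.2] using norm_trace_mul_le W hρ.1

/-- A channel with entanglement fidelity close to one is close to the identity. -/
theorem norm_trace_mul_ampliate_sub_le [Nonempty n] {Λ : Superop n} (hΛ : HasKraus Λ)
    {ρ : Matrix (n × m) (n × m) ℂ} (hρ : IsDensity ρ) {W : Matrix (n × m) (n × m) ℂ}
    (hW : ‖W‖ ≤ 1) :
    ‖(W * (ampliate Λ m ρ - ρ)).trace‖ ≤
      (Fintype.card n + √(Fintype.card n) + 1) * √(1 - entanglementFidelity Λ) := by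
  have hF0 := entanglementFidelity_nonneg hΛ
  have hF1 := entanglementFidelity_le_one hΛ
  obtain ⟨L, _, K, hK⟩ := hΛ
  set F := entanglementFidelity Λ
  set d : ℝ := (Fintype.card n : ℝ) with hd
  have hd0 : 0 < d := by rw [hd]; exact_mod_cast Fintype.card_pos
  -- Write $K_l=Z_l+x_l1$ with $Z_l$ traceless. Then $K\rho K^\dagger=Z\rho K^\dagger+x\,\rho
  -- Z^\dagger+|x|^2\rho$, and $\sum_l|x_l|^2=F$, so only $(1-F)\rho$ is left uncancelled.
  let x : L → ℂ := fun l => (Fintype.card n : ℂ)⁻¹ * (K l).trace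
  let Z : L → Matrix n n ℂ := fun l => K l - x l • 1
  let I : Matrix m m ℂ := 1
  have hxF : ∑ l, ‖x l‖ ^ 2 = F := by
    simp only [x, norm_mul, norm_inv, Complex.norm_natCast, mul_pow, ← Finset.mul_sum]
    rw [inv_pow]
    exact hK.entanglementFidelity_eq.symm
  have hsplit : ∀ l, (K l ⊗ₖ I) * ρ * (K l ⊗ₖ I)ᴴ = (Z l ⊗ₖ I) * ρ * (K l ⊗ₖ I)ᴴ +
      x l • (ρ * (Z l ⊗ₖ I)ᴴ) + (((‖x l‖ ^ 2 : ℝ) : ℂ)) • ρ := by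
    intro l
    have hKl : K l ⊗ₖ I = Z l ⊗ₖ I + x l • 1 := by
      have h1 : K l = Z l + x l • 1 := by simp [Z]
      conv_lhs => rw [h1]
      rw [Matrix.add_kronecker, Matrix.smul_kronecker, Matrix.one_kronecker_one]
    have h2 : (K l ⊗ₖ I)ᴴ = (Z l ⊗ₖ I)ᴴ + star (x l) • 1 := by
      rw [hKl, Matrix.conjTranspose_add, Matrix.conjTranspose_smul, Matrix.conjTranspose_one]
    have h3 : (((‖x l‖ ^ 2 : ℝ) : ℂ)) = x l * star (x l) := by
      rw [RCLike.star_def, Complex.mul_conj']; push_cast; rfl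
    calc (K l ⊗ₖ I) * ρ * (K l ⊗ₖ I)ᴴ =
          (Z l ⊗ₖ I) * ρ * (K l ⊗ₖ I)ᴴ + x l • (ρ * (K l ⊗ₖ I)ᴴ) := by
          conv_lhs => rw [hKl, add_mul, add_mul, ← hKl]
          rw [Matrix.smul_mul, Matrix.one_mul, Matrix.smul_mul]
      _ = _ := by
          rw [h3, add_assoc]
          congr 1
          rw [h2, mul_add, smul_add, Matrix.mul_smul, Matrix.mul_one, smul_smul]
  have hdiff : ampliate Λ m ρ - ρ = ∑ l, ((Z l ⊗ₖ I) * ρ * (K l ⊗ₖ I)ᴴ +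
      x l • (ρ * (Z l ⊗ₖ I)ᴴ)) - ((1 - F : ℝ) : ℂ) • ρ := by
    rw [hK.ampliate]
    simp only [← hxF]
    rw [Finset.sum_congr rfl fun l _ => hsplit l, Finset.sum_add_distrib, ← Finset.sum_smul,
      Complex.ofReal_sub, Complex.ofReal_sum, sub_smul, Complex.ofReal_one, one_smul]
    abel
  have hz : ∀ l, ‖Z l ⊗ₖ I‖ ≤ √(frobeniusSq (Z l)) := fun l => l2_opNorm_kronecker_one_le m _
  have hk : ∀ l, ‖K l ⊗ₖ I‖ ≤ √(frobeniusSq (K l)) := fun l => l2_opNorm_kronecker_one_le m _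
  have hterm : ∀ l, ‖(W * ((Z l ⊗ₖ I) * ρ * (K l ⊗ₖ I)ᴴ + x l • (ρ * (Z l ⊗ₖ I)ᴴ))).trace‖ ≤
      √(frobeniusSq (K l)) * √(frobeniusSq (Z l)) + ‖x l‖ * √(frobeniusSq (Z l)) := by
    intro l
    rw [mul_add, Matrix.trace_add]
    refine (norm_add_le _ _).trans (add_le_add ?_ ?_)
    · have h1 : (W * ((Z l ⊗ₖ I) * ρ * (K l ⊗ₖ I)ᴴ)).trace =
          (((K l ⊗ₖ I)ᴴ * W * (Z l ⊗ₖ I)) * ρ).trace := by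
        rw [← Matrix.mul_assoc, Matrix.trace_mul_comm]
        simp only [Matrix.mul_assoc]
      rw [h1]
      refine (norm_trace_mul_le_of_isDensity _ hρ).trans ?_
      calc ‖(K l ⊗ₖ I)ᴴ * W * (Z l ⊗ₖ I)‖ ≤ ‖(K l ⊗ₖ I)ᴴ‖ * ‖W‖ * ‖Z l ⊗ₖ I‖ :=
            (Matrix.l2_opNorm_mul _ _).trans
              (mul_le_mul_of_nonneg_right (Matrix.l2_opNorm_mul _ _) (norm_nonneg _))
        _ ≤ √(frobeniusSq (K l)) * 1 * √(frobeniusSq (Z l)) := by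
            rw [Matrix.l2_opNorm_conjTranspose]
            gcongr
            · exact hk l
            · exact hz l
        _ = _ := by ring
    · rw [Matrix.mul_smul, Matrix.trace_smul, norm_smul]
      refine mul_le_mul_of_nonneg_left ?_ (norm_nonneg _)
      rw [← Matrix.mul_assoc, Matrix.trace_mul_comm, ← Matrix.mul_assoc]
      refine (norm_trace_mul_le_of_isDensity _ hρ).trans ((Matrix.l2_opNorm_mul _ _).trans ?_)
      rw [Matrix.l2_opNorm_conjTranspose]
      calc _ ≤ √(frobeniusSq (Z l)) * 1 := by gcongr; exact hz l
        _ = _ := mul_one _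
  have hZsum : ∑ l, frobeniusSq (Z l) = d * (1 - F) := hK.sum_frobeniusSq_sub
  have hKsum : ∑ l, frobeniusSq (K l) = d := hK.sum_frobeniusSq
  -- The three summands of the constant $d+\sqrt d+1$ arise here: $d$ from Cauchy–Schwarz between
  -- the $K_l$ and the $Z_l$, $\sqrt d$ from that between the $x_l$ and the $Z_l$, and $1$ from the
  -- remainder $(1-F)\rho$.
  have hs1 : ∑ l, √(frobeniusSq (K l)) * √(frobeniusSq (Z l)) ≤ d * √(1 - F) := by
    refine (Real.sum_sqrt_mul_sqrt_le _ (fun l => frobeniusSq_nonneg _)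
      (fun l => frobeniusSq_nonneg _)).trans ?_
    rw [hZsum, hKsum, Real.sqrt_mul hd0.le, ← mul_assoc, Real.mul_self_sqrt hd0.le]
  have hs2 : ∑ l, ‖x l‖ * √(frobeniusSq (Z l)) ≤ √d * √(1 - F) := by
    have h1 : ∀ l, ‖x l‖ * √(frobeniusSq (Z l)) = √(‖x l‖ ^ 2) * √(frobeniusSq (Z l)) := fun l => by
      rw [Real.sqrt_sq (norm_nonneg _)]
    simp only [h1]
    refine (Real.sum_sqrt_mul_sqrt_le _ (fun l => by positivity)
      (fun l => frobeniusSq_nonneg _)).trans ?_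
    rw [hZsum, hxF, Real.sqrt_mul hd0.le]
    have : √F ≤ 1 := Real.sqrt_le_one.mpr hF1
    nlinarith [mul_nonneg (Real.sqrt_nonneg d) (Real.sqrt_nonneg (1 - F))]
  have hs3 : ‖(W * (((1 - F : ℝ) : ℂ) • ρ)).trace‖ ≤ √(1 - F) := by
    rw [Matrix.mul_smul, Matrix.trace_smul, norm_smul, Complex.norm_real,
      Real.norm_of_nonneg (by linarith)]
    have h1 := (norm_trace_mul_le_of_isDensity W hρ).trans hW
    have h2 : 1 - F ≤ √(1 - F) := by
      apply Real.le_sqrt_of_sq_le; nlinarith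
    calc _ ≤ (1 - F) * 1 := mul_le_mul_of_nonneg_left h1 (by linarith)
      _ ≤ _ := by linarith
  rw [hdiff, mul_sub, Matrix.trace_sub, Finset.mul_sum, Matrix.trace_sum]
  refine (norm_sub_le _ _).trans ?_
  have h4 := (norm_sum_le Finset.univ fun l =>
    (W * ((Z l ⊗ₖ I) * ρ * (K l ⊗ₖ I)ᴴ + x l • (ρ * (Z l ⊗ₖ I)ᴴ))).trace).trans
    (Finset.sum_le_sum fun l _ => hterm l)
  rw [Finset.sum_add_distrib] at h4
  linarith

theorem hasKraus_compose {k : ℕ} {f : Fin k → Superop n} (hf : ∀ j, HasKraus (f j)) :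
    HasKraus (compose k f) := by
  induction k with
  | zero => exact HasKraus.id
  | succ k ih => exact (hf _).comp (ih fun j => hf _)

/-- The telescoping estimate for a product of noisy unitary channels. -/
theorem norm_trace_mul_compose_sub_le [Nonempty n] {k : ℕ} (U : Fin k → unitaryGroup n ℂ)
    {Λ : Fin k → Superop n} (hΛ : ∀ j, HasKraus (Λ j)) {ρ : Matrix (n × m) (n × m) ℂ}
    (hρ : IsDensity ρ) {W : Matrix (n × m) (n × m) ℂ} (hW : ‖W‖ ≤ 1) :
    ‖(W * (ampliate (compose k fun j => unitaryChannel (U j) ∘ₗ Λ j) m ρ -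
        ampliate (compose k fun j => unitaryChannel (U j)) m ρ)).trace‖ ≤
      ∑ j, (Fintype.card n + √(Fintype.card n) + 1) * √(1 - entanglementFidelity (Λ j)) := by
  -- The contraction `W` varies in the induction because the last unitary is moved onto it, turning
  -- it into $V^\dagger WV$.
  induction k generalizing W with
  | zero => simp [compose]
  | succ k ih =>
    rw [Fin.sum_univ_castSucc]
    simp only [compose, ampliate_comp, ampliate_unitaryChannel]
    set σ := ampliate (compose k fun j => unitaryChannel (U j.castSucc) ∘ₗ Λ j.castSucc) m ρ
    set τ := ampliate (compose k fun j => unitaryChannel (U j.castSucc)) m ρ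
    set V := (U (Fin.last k) : Matrix n n ℂ) ⊗ₖ (1 : Matrix m m ℂ)
    have hV : Vᴴ * V = 1 := by
      rw [Matrix.conjTranspose_kronecker, ← Matrix.mul_kronecker_mul,
        unitary_conjTranspose_mul_self, Matrix.conjTranspose_one, Matrix.mul_one,
        Matrix.one_kronecker_one]
    have hσ : IsDensity σ := (hasKraus_compose fun j =>
      (HasKraus.unitaryChannel _).comp (hΛ _)).ampliate_isDensity hρ
    have hW' : ‖Vᴴ * W * V‖ ≤ 1 := by
      have h1 := l2_opNorm_unitary_le hV
      have h2 : ‖Vᴴ‖ ≤ 1 := by rwa [Matrix.l2_opNorm_conjTranspose]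
      calc ‖Vᴴ * W * V‖ ≤ ‖Vᴴ‖ * ‖W‖ * ‖V‖ :=
            (Matrix.l2_opNorm_mul _ _).trans
              (mul_le_mul_of_nonneg_right (Matrix.l2_opNorm_mul _ _) (norm_nonneg _))
        _ ≤ 1 * 1 * 1 := by gcongr
        _ = 1 := by norm_num
    have h : (W * (V * ampliate (Λ (Fin.last k)) m σ * Vᴴ - V * τ * Vᴴ)).trace =
        ((Vᴴ * W * V) * (σ - τ)).trace +
        ((Vᴴ * W * V) * (ampliate (Λ (Fin.last k)) m σ - σ)).trace := by
      rw [← Matrix.trace_add, ← mul_add, ← sub_mul, ← mul_sub, ← Matrix.mul_assoc,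
        Matrix.trace_mul_comm]
      simp only [← Matrix.mul_assoc]
      congr 2
      abel
    rw [h]
    exact (norm_add_le _ _).trans (add_le_add (ih _ (fun j => hΛ _) hW')
      (norm_trace_mul_ampliate_sub_le (hΛ _) hσ hW'))

theorem diamondDist_compose_le [Nonempty n] {k : ℕ} (U : Fin k → unitaryGroup n ℂ)
    {Λ : Fin k → Superop n} (hΛ : ∀ j, HasKraus (Λ j)) :
    diamondDist (compose k fun j => unitaryChannel (U j) ∘ₗ Λ j)
        (compose k fun j => unitaryChannel (U j)) ≤
      ENNReal.ofReal (∑ j, (Fintype.card n + √(Fintype.card n) + 1) *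
        √(1 - entanglementFidelity (Λ j))) :=
  iSup_le fun _ => iSup_le fun _ => iSup_le fun hρ => ENNReal.ofReal_le_ofReal <|
    traceNorm_le fun _ hW => norm_trace_mul_compose_sub_le U hΛ hρ hW

end Diamond

/-! ### Averages of the test over gates and input states -/

section Rounds

variable {Q : ℕ}

/-- The noise of round `j`, relative to the ideal memory. -/
def roundError (Q : ℕ) (𝒩 : NoiseModel) (j : ℕ) : Superop (Qubits Q) :=
  unitaryChannel (tensorUnitary Q (𝒩.memory j))⁻¹ ∘ₗ tensorPower Q (𝒩.gateNoise j) ∘ₗ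
    tensorPower Q (𝒩.store j) ∘ₗ tensorPower Q (𝒩.send j)

theorem hasKraus_roundError (𝒩 : NoiseModel) (j : ℕ) : HasKraus (roundError Q 𝒩 j) :=
  (HasKraus.unitaryChannel _).comp <| ((𝒩.gateNoise_isChannel j).hasKraus.tensorPower Q).comp <|
    ((𝒩.store_isChannel j).hasKraus.tensorPower Q).comp <|
      (𝒩.send_isChannel j).hasKraus.tensorPower Q

theorem idealRound_eq (𝒩 : NoiseModel) (j : ℕ) (g : Superop (Qubits Q)) :
    idealRound 𝒩 j g = g ∘ₗ unitaryChannel (tensorUnitary Q (𝒩.memory j)) := by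
  rw [idealRound, tensorPower_unitaryChannel]

/-- The ideal memory is inserted together with its inverse, so that the whole deviation from the
ideal round sits in a channel before it. -/
theorem noisyRound_eq (𝒩 : NoiseModel) (j : ℕ) (g : Superop (Qubits Q)) :
    noisyRound 𝒩 j g =
      g ∘ₗ unitaryChannel (tensorUnitary Q (𝒩.memory j)) ∘ₗ roundError Q 𝒩 j := by
  ext1 X
  have h := LinearMap.congr_fun (unitaryChannel_comp_inv (tensorUnitary Q (𝒩.memory j)))
  simp only [LinearMap.comp_apply, LinearMap.id_apply] at h
  simp only [noisyRound, roundError, LinearMap.comp_apply, h]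

theorem noisyRun_succ {k : ℕ} (𝒩 : NoiseModel) (g : Fin (k + 1) → Superop (Qubits Q))
    (A : Matrix (Qubits Q) (Qubits Q) ℂ) :
    noisyRun 𝒩 g A = g (Fin.last k) (unitaryChannel (tensorUnitary Q (𝒩.memory k))
      (roundError Q 𝒩 k (noisyRun 𝒩 (fun j => g j.castSucc) A))) := by
  simp only [noisyRun, compose, noisyRound_eq, LinearMap.comp_apply, Fin.val_last,
    Fin.val_castSucc]

theorem idealRun_succ {k : ℕ} (𝒩 : NoiseModel) (g : Fin (k + 1) → Superop (Qubits Q))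
    (A : Matrix (Qubits Q) (Qubits Q) ℂ) :
    idealRun 𝒩 g A = g (Fin.last k) (unitaryChannel (tensorUnitary Q (𝒩.memory k))
      (idealRun 𝒩 (fun j => g j.castSucc) A)) := by
  simp only [idealRun, compose, idealRound_eq, LinearMap.comp_apply, Fin.val_last,
    Fin.val_castSucc]

theorem trace_noisyRun {k : ℕ} (𝒩 : NoiseModel) {g : Fin k → Superop (Qubits Q)}
    (hg : ∀ j X, (g j X).trace = X.trace) (A : Matrix (Qubits Q) (Qubits Q) ℂ) :
    (noisyRun 𝒩 g A).trace = A.trace := by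
  induction k with
  | zero => rfl
  | succ k ih =>
    rw [noisyRun_succ, hg, trace_unitaryChannel, (hasKraus_roundError 𝒩 k).trace,
      ih fun j => hg _]

theorem trace_idealRun {k : ℕ} (𝒩 : NoiseModel) {g : Fin k → Superop (Qubits Q)}
    (hg : ∀ j X, (g j X).trace = X.trace) (A : Matrix (Qubits Q) (Qubits Q) ℂ) :
    (idealRun 𝒩 g A).trace = A.trace := by
  induction k with
  | zero => rfl
  | succ k ih =>
    rw [idealRun_succ, hg, trace_unitaryChannel, ih fun j => hg _]

/-- The depolarizing parameter of the twirled noise of round `j`. -/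
def roundParam (Q : ℕ) (𝒩 : NoiseModel) (j : ℕ) : ℝ := depolarizingParam (roundError Q 𝒩 j)

/-- The gates `c_j ∘ U_j` for Clifford channels `c_j` and unitaries `U_j`. -/
def cliffordGates {k : ℕ} (U : Fin k → unitaryGroup (Qubits Q) ℂ) (c : Fin k → cliffordGroup Q)
    (j : Fin k) : Superop (Qubits Q) :=
  (c j : Superop (Qubits Q)) ∘ₗ unitaryChannel (U j)

theorem trace_cliffordGates {k : ℕ} (U : Fin k → unitaryGroup (Qubits Q) ℂ)
    (c : Fin k → cliffordGroup Q) (j : Fin k) (X : Matrix (Qubits Q) (Qubits Q) ℂ) :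
    (cliffordGates U c j X).trace = X.trace := by
  rw [cliffordGates, LinearMap.comp_apply, trace_mem_cliffordGroup, trace_unitaryChannel]

theorem sum_fin_succ_eq {M α : Type*} [AddCommMonoid M] [Fintype α] {k : ℕ}
    (f : (Fin (k + 1) → α) → M) :
    ∑ c, f c = ∑ c : Fin k → α, ∑ a, f (Fin.snoc (α := fun _ => α) c a) := by
  rw [← (Fin.snocEquiv fun _ => α).sum_comp, Fintype.sum_prod_type_right]
  rfl

theorem card_cliffordGroup : Fintype.card (cliffordGroup Q) = (cliffordGroup Q).ncard := by
  rw [← Nat.card_coe_set_eq, Nat.card_eq_fintype_card]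

/-- The error of the round to come is kept pending, so that each inductive step has a twirl to
perform: the newest Clifford gate twirls it into a depolarizing channel, and the common unitaries
then cancel, exposing the error of the previous round. Only the error of round 0 stays untwirled,
for lack of a gate before it. -/
theorem sum_trace_noisyRun_mul_idealRun (hQ : Q ≠ 0) (𝒩 : NoiseModel) {k : ℕ}
    (U : Fin k → unitaryGroup (Qubits Q) ℂ) (A B : Matrix (Qubits Q) (Qubits Q) ℂ) :
    ∑ c : Fin k → cliffordGroup Q, (roundError Q 𝒩 k (noisyRun 𝒩 (cliffordGates U c) A) *
        idealRun 𝒩 (cliffordGates U c) B).trace =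
      (cliffordGroup Q).ncard ^ k *
        depolarizingForm (∏ j ∈ Finset.range k, roundParam Q 𝒩 (j + 1)) (roundError Q 𝒩 0 A) B := by
  induction k with
  | zero => simp [depolarizingForm, noisyRun, idealRun, compose]
  | succ k ih =>
    rw [sum_fin_succ_eq]
    have h : ∀ c : Fin k → cliffordGroup Q,
        ∑ a, (roundError Q 𝒩 (k + 1)
          (noisyRun 𝒩 (cliffordGates U (Fin.snoc (α := fun _ => cliffordGroup Q) c a)) A) *
          idealRun 𝒩 (cliffordGates U (Fin.snoc (α := fun _ => cliffordGroup Q) c a)) B).trace =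
        (cliffordGroup Q).ncard * (roundParam Q 𝒩 (k + 1) *
          (roundError Q 𝒩 k (noisyRun 𝒩 (cliffordGates (fun j => U j.castSucc) c) A) *
            idealRun 𝒩 (cliffordGates (fun j => U j.castSucc) c) B).trace +
          (1 - roundParam Q 𝒩 (k + 1)) * (2 ^ Q)⁻¹ * (A.trace * B.trace)) := by
      intro c
      have hg : ∀ a, (fun j : Fin k => cliffordGates U (Fin.snoc (α := fun _ => cliffordGroup Q) c a)
          j.castSucc) = cliffordGates (fun j => U j.castSucc) c := by
        intro a
        ext1 j
        simp only [cliffordGates, Fin.snoc_castSucc]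
      simp only [noisyRun_succ, idealRun_succ, hg]
      simp only [cliffordGates, Fin.snoc_last, LinearMap.comp_apply]
      rw [clifford_twirl hQ (hasKraus_roundError 𝒩 (k + 1)), depolarizingForm,
        trace_unitaryChannel_mul, trace_unitaryChannel_mul]
      simp only [trace_unitaryChannel]
      rw [(hasKraus_roundError 𝒩 k).trace, trace_noisyRun, trace_idealRun]
      · rfl
      · exact trace_cliffordGates _ c
      · exact trace_cliffordGates _ c
    simp only [h]
    rw [← Finset.mul_sum, Finset.sum_add_distrib, ← Finset.mul_sum, ih, Finset.sum_const,
      Finset.card_univ, Fintype.card_fun, Fintype.card_fin, card_cliffordGroup, nsmul_eq_mul,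
      Finset.prod_range_succ, depolarizingForm, depolarizingForm,
      (hasKraus_roundError 𝒩 0).trace]
    push_cast
    ring

/-- The average over Clifford gates of the fidelity of the noisy test. -/
theorem sum_trace_cliffordGates (hQ : Q ≠ 0) (𝒩 : NoiseModel) {k : ℕ}
    (U : Fin (k + 1) → unitaryGroup (Qubits Q) ℂ) (A B : Matrix (Qubits Q) (Qubits Q) ℂ) :
    ∑ c : Fin (k + 1) → cliffordGroup Q, (noisyRun 𝒩 (cliffordGates U c) A *
        idealRun 𝒩 (cliffordGates U c) B).trace =
      (cliffordGroup Q).ncard ^ (k + 1) *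
        depolarizingForm (∏ j ∈ Finset.range k, roundParam Q 𝒩 (j + 1)) (roundError Q 𝒩 0 A) B := by
  rw [sum_fin_succ_eq, pow_succ, mul_right_comm,
    ← sum_trace_noisyRun_mul_idealRun hQ 𝒩 (fun j => U j.castSucc), Finset.sum_mul]
  refine Finset.sum_congr rfl fun c _ => ?_
  have hg : ∀ a, (fun j : Fin k => cliffordGates U (Fin.snoc (α := fun _ => cliffordGroup Q) c a)
      j.castSucc) = cliffordGates (fun j => U j.castSucc) c := by
    intro a
    ext1 j
    simp only [cliffordGates, Fin.snoc_castSucc]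
  simp only [noisyRun_succ, idealRun_succ, hg]
  -- Nothing follows the last gate, so it cancels between the noisy and the ideal output, and
  -- summing over it only contributes the order of the group.
  simp only [cliffordGates, LinearMap.comp_apply, trace_mul_mem_cliffordGroup,
    trace_unitaryChannel_mul, Finset.sum_const, Finset.card_univ, card_cliffordGroup,
    nsmul_eq_mul]
  rw [mul_comm]

end Rounds

/-! ### Haar and 2-design averages as finite Clifford sums -/

section HaarAverage

variable {n : Type} [Fintype n] [DecidableEq n]

instance : SecondCountableTopology (unitaryGroup n ℂ) :=
  haveI : SecondCountableTopology (Matrix n n ℂ) :=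
    inferInstanceAs (SecondCountableTopology (n → n → ℂ))
  Topology.IsEmbedding.subtypeVal.secondCountableTopology

instance : (haarUnitary n).IsMulLeftInvariant :=
  inferInstanceAs (Measure.haarMeasure ⊤).IsMulLeftInvariant

/-- By left invariance all translates have the same integral, so finitely many translates with
constant sum determine it. This replaces integration formulas over the unitary group. -/
theorem card_mul_integral_eq {G : Type*} [Group G] [MeasurableSpace G] [MeasurableMul G]
    (μ : Measure G) [IsProbabilityMeasure μ] [μ.IsMulLeftInvariant] {ι : Type*} [Fintype ι]
    (g : ι → G) {f : G → ℝ} (hf : Integrable f μ) {K : ℝ} (h : ∀ x, ∑ i, f (g i * x) = K) :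
    Fintype.card ι * ∫ x, f x ∂μ = K := by
  have h1 : ∑ i, ∫ x, f (g i * x) ∂μ = K := by
    rw [← integral_finsetSum _ fun i _ => hf.comp_mul_left (g i)]
    simp [h]
  simpa [integral_mul_left_eq_self] using h1

theorem continuous_superop (Φ : Superop n) : Continuous fun X => Φ X :=
  LinearMap.continuous_of_finiteDimensional Φ

theorem continuous_unitaryChannel {T : Type*} [TopologicalSpace T] {U : T → unitaryGroup n ℂ}
    {X : T → Matrix n n ℂ} (hU : Continuous U) (hX : Continuous X) :
    Continuous fun t => unitaryChannel (U t) (X t) := by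
  simp only [unitaryChannel_apply]
  have h := continuous_subtype_val.comp hU
  exact (h.matrix_mul hX).matrix_mul h.matrix_conjTranspose

variable {Q : ℕ}

theorem continuous_pureState : Continuous fun U : unitaryGroup (Qubits Q) ℂ => pureState U :=
  continuous_unitaryChannel continuous_id continuous_const

theorem continuous_noisyRun {T : Type*} [TopologicalSpace T] (𝒩 : NoiseModel) {k : ℕ}
    {U : T → Fin k → unitaryGroup (Qubits Q) ℂ} {X : T → Matrix (Qubits Q) (Qubits Q) ℂ}
    (hU : Continuous U) (hX : Continuous X) :
    Continuous fun t => noisyRun 𝒩 (fun j => unitaryChannel (U t j)) (X t) := by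
  induction k with
  | zero => exact hX
  | succ k ih =>
    simp only [noisyRun_succ]
    have hU' : ∀ j, Continuous fun t => U t j := fun j => (continuous_apply j).comp hU
    exact continuous_unitaryChannel (hU' _) <| continuous_unitaryChannel continuous_const <|
      (continuous_superop _).comp (ih (U := fun t j => U t j.castSucc)
        (continuous_pi fun j => hU' _))

theorem continuous_idealRun {T : Type*} [TopologicalSpace T] (𝒩 : NoiseModel) {k : ℕ}
    {U : T → Fin k → unitaryGroup (Qubits Q) ℂ} {X : T → Matrix (Qubits Q) (Qubits Q) ℂ}
    (hU : Continuous U) (hX : Continuous X) :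
    Continuous fun t => idealRun 𝒩 (fun j => unitaryChannel (U t j)) (X t) := by
  induction k with
  | zero => exact hX
  | succ k ih =>
    simp only [idealRun_succ]
    have hU' : ∀ j, Continuous fun t => U t j := fun j => (continuous_apply j).comp hU
    exact continuous_unitaryChannel (hU' _) <| continuous_unitaryChannel continuous_const <|
      ih (U := fun t j => U t j.castSucc) (continuous_pi fun j => hU' _)

theorem continuous_trace_mul {T : Type*} [TopologicalSpace T]
    {X Y : T → Matrix (Qubits Q) (Qubits Q) ℂ} (hX : Continuous X) (hY : Continuous Y) :
    Continuous fun t => (X t * Y t).trace :=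
  (hX.matrix_mul hY).matrix_trace

theorem integrable_of_continuous {G E : Type*} [TopologicalSpace G] [CompactSpace G]
    [MeasurableSpace G] [OpensMeasurableSpace G] [NormedAddCommGroup E]
    [SecondCountableTopologyEither G E] (μ : Measure G) [IsFiniteMeasure μ] {f : G → E}
    (hf : Continuous f) : Integrable f μ :=
  hf.integrable_of_hasCompactSupport (HasCompactSupport.of_compactSpace f)

theorem trace_pureState (U : unitaryGroup (Qubits Q) ℂ) : (pureState U).trace = 1 := by
  rw [pureState, trace_unitaryChannel]; simp

theorem pureState_mul_self (U : unitaryGroup (Qubits Q) ℂ) :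
    pureState U * pureState U = pureState U := by
  rw [pureState, unitaryChannel_mul_apply]; simp

theorem continuous_depolarizingForm {T : Type*} [TopologicalSpace T] (p : ℝ)
    {X Y : T → Matrix (Qubits Q) (Qubits Q) ℂ} (hX : Continuous X) (hY : Continuous Y) :
    Continuous fun t => depolarizingForm p (X t) (Y t) := by
  unfold depolarizingForm
  exact (continuous_const.mul (continuous_trace_mul hX hY)).add
    (continuous_const.mul (hX.matrix_trace.mul hY.matrix_trace))

/-- A unitary that represents an element of the Clifford group. -/
def cliffordUnitary (Φ : cliffordGroup Q) : unitaryGroup (Qubits Q) ℂ := Φ.2.choose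

theorem unitaryChannel_cliffordUnitary (Φ : cliffordGroup Q) :
    unitaryChannel (cliffordUnitary Φ) = Φ := Φ.2.choose_spec.2.symm

theorem ncard_cliffordGroup_pos : (0 : ℝ) < (cliffordGroup Q).ncard := by
  have h := pow_le_ncard_cliffordGroup Q
  have h2 : 0 < 4 ^ Q := by positivity
  exact_mod_cast h2.trans_le h

/-- The average of the fidelity over Haar random input states. -/
theorem integral_depolarizingForm (hQ : Q ≠ 0) {Λ : Superop (Qubits Q)} (hΛ : HasKraus Λ) (q : ℝ) :
    ∫ V, (depolarizingForm q (Λ (pureState V)) (pureState V)).re ∂(haarUnitary (Qubits Q)) =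
      (2 ^ Q)⁻¹ + (1 - (2 ^ Q)⁻¹) * (q * depolarizingParam Λ) := by
  have hC := ncard_cliffordGroup_pos (Q := Q)
  refine mul_left_cancel₀ hC.ne' ?_
  rw [← card_cliffordGroup]
  -- The random input state absorbs a Clifford, which twirls `Λ`; this handles the error of round 0.
  refine card_mul_integral_eq _ cliffordUnitary (integrable_of_continuous _
    (Complex.continuous_re.comp (continuous_depolarizingForm q
      ((continuous_superop Λ).comp continuous_pureState) continuous_pureState))) fun V => ?_
  have hp : ∀ Φ : cliffordGroup Q, pureState (cliffordUnitary Φ * V) =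
      (Φ : Superop (Qubits Q)) (pureState V) := fun Φ => by
    rw [pureState, unitaryChannel_mul, unitaryChannel_cliffordUnitary]; rfl
  simp only [Function.comp_apply, hp]
  rw [← Complex.re_sum]
  simp only [depolarizingForm, hΛ.trace, trace_mem_cliffordGroup, trace_pureState]
  rw [Finset.sum_add_distrib, ← Finset.mul_sum, clifford_twirl hQ hΛ, depolarizingForm,
    pureState_mul_self, trace_pureState, Finset.sum_const, Finset.card_univ, nsmul_eq_mul,
    card_cliffordGroup]
  refine (congrArg Complex.re (?_ : _ = ((_ : ℝ) : ℂ))).trans (Complex.ofReal_re _)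
  push_cast
  ring

/-- The fidelity of the noisy test with gates `U` and input state `V|0⟩`. -/
def testFidelity (𝒩 : NoiseModel) {k : ℕ} (U : Fin k → unitaryGroup (Qubits Q) ℂ)
    (V : unitaryGroup (Qubits Q) ℂ) : ℝ :=
  ((noisyRun 𝒩 (fun j => unitaryChannel (U j)) (pureState V) *
    idealRun 𝒩 (fun j => unitaryChannel (U j)) (pureState V)).trace).re

theorem continuous_testFidelity (𝒩 : NoiseModel) (k : ℕ) :
    Continuous (Function.uncurry (testFidelity (Q := Q) 𝒩 (k := k))) :=
  Complex.continuous_re.comp (continuous_trace_mul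
    (continuous_noisyRun 𝒩 continuous_fst (continuous_pureState.comp continuous_snd))
    (continuous_idealRun 𝒩 continuous_fst (continuous_pureState.comp continuous_snd)))

theorem integrable_testFidelity (𝒩 : NoiseModel) {k : ℕ}
    (U : Fin k → unitaryGroup (Qubits Q) ℂ) :
    Integrable (testFidelity 𝒩 U) (haarUnitary (Qubits Q)) := by
  have h : Continuous (testFidelity 𝒩 U) :=
    Complex.continuous_re.comp (continuous_trace_mul
      (continuous_noisyRun 𝒩 continuous_const continuous_pureState)
      (continuous_idealRun 𝒩 continuous_const continuous_pureState))
  exact integrable_of_continuous _ h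

theorem integrable_integral_testFidelity (𝒩 : NoiseModel) (k : ℕ) :
    Integrable (fun U : Fin k → unitaryGroup (Qubits Q) ℂ =>
      ∫ V, testFidelity 𝒩 U V ∂(haarUnitary (Qubits Q)))
      (Measure.pi fun _ => haarUnitary (Qubits Q)) := by
  have h := continuous_parametric_integral_of_continuous (μ := haarUnitary (Qubits Q))
    (s := Set.univ) (continuous_testFidelity (Q := Q) 𝒩 k) isCompact_univ
  simp only [Measure.restrict_univ] at h
  exact integrable_of_continuous _ h

theorem re_ncard_pow_mul (k : ℕ) (z : ℂ) :
    (((cliffordGroup Q).ncard : ℂ) ^ k * z).re = ((cliffordGroup Q).ncard : ℝ) ^ k * z.re := by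
  rw [← Complex.re_ofReal_mul]; push_cast; rfl

/-- Multiplying the gates by all tuples of Cliffords gives a total independent of `U`, which is what
`card_mul_integral_eq` asks for on the product group. -/
theorem sum_integral_testFidelity (hQ : Q ≠ 0) (𝒩 : NoiseModel) {k : ℕ}
    (U : Fin (k + 1) → unitaryGroup (Qubits Q) ℂ) :
    ∑ c : Fin (k + 1) → cliffordGroup Q, ∫ V, testFidelity 𝒩
        ((fun j => cliffordUnitary (c j)) * U) V ∂(haarUnitary (Qubits Q)) =
      ((cliffordGroup Q).ncard : ℝ) ^ (k + 1) *
        ((2 ^ Q)⁻¹ + (1 - (2 ^ Q)⁻¹) * ∏ j ∈ Finset.range (k + 1), roundParam Q 𝒩 j) := by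
  have hgate : ∀ (c : Fin (k + 1) → cliffordGroup Q) V,
      testFidelity 𝒩 ((fun j => cliffordUnitary (c j)) * U) V =
        ((noisyRun 𝒩 (cliffordGates U c) (pureState V) *
          idealRun 𝒩 (cliffordGates U c) (pureState V)).trace).re := fun c V => by
    have h : (fun j => unitaryChannel (((fun j => cliffordUnitary (c j)) * U) j)) =
        cliffordGates U c := by
      ext1 j
      rw [Pi.mul_apply, unitaryChannel_mul, unitaryChannel_cliffordUnitary]
      rfl
    rw [testFidelity, h]
  rw [← integral_finsetSum _ fun c _ => integrable_testFidelity 𝒩 _]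
  simp only [hgate, ← Complex.re_sum, sum_trace_cliffordGates hQ, re_ncard_pow_mul]
  rw [integral_const_mul, integral_depolarizingForm hQ (hasKraus_roundError 𝒩 0),
    Finset.prod_range_succ']
  rfl

/-- The double-averaged fidelity in terms of the depolarizing parameters. -/
theorem doubleAvgFidelity_eq (hQ : Q ≠ 0) (𝒩 : NoiseModel) {k : ℕ} (hk : k ≠ 0) :
    doubleAvgFidelity Q 𝒩 k =
      (2 ^ Q)⁻¹ + (1 - (2 ^ Q)⁻¹) * ∏ j ∈ Finset.range k, roundParam Q 𝒩 j := by
  obtain ⟨k, rfl⟩ := Nat.exists_eq_succ_of_ne_zero hk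
  refine mul_left_cancel₀ (pow_pos (ncard_cliffordGroup_pos (Q := Q)) (k + 1)).ne' ?_
  have h := card_mul_integral_eq (Measure.pi fun _ : Fin (k + 1) => haarUnitary (Qubits Q))
    (fun (c : Fin (k + 1) → cliffordGroup Q) j => cliffordUnitary (c j))
    (integrable_integral_testFidelity 𝒩 (k + 1)) (sum_integral_testFidelity hQ 𝒩)
  rw [Fintype.card_fun, Fintype.card_fin, card_cliffordGroup, Nat.cast_pow] at h
  exact h

/-- Projective 2-designs average bilinear functions of the state like the Haar measure. -/
theorem IsProjectiveTwoDesign.average_trace {ι : Type*} [Fintype ι] {x : ι → Qubits Q → ℂ}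
    (hx : IsProjectiveTwoDesign x) (Ψ : Superop (Qubits Q)) :
    (Fintype.card ι : ℂ)⁻¹ * ∑ i, (Ψ (vecMulVec (x i) (star (x i))) *
        vecMulVec (x i) (star (x i))).trace =
      ∫ V, (Ψ (pureState V) * pureState V).trace ∂(haarUnitary (Qubits Q)) := by
  -- The trace is a linear function of the entries of $A\otimes B$, so the entrywise design identity
  -- applies to it.
  have key : ∀ A B : Matrix (Qubits Q) (Qubits Q) ℂ, (Ψ A * B).trace =
      ∑ a, ∑ b, ∑ c, ∑ d, Ψ (Matrix.single a b 1) c d * (A ⊗ₖ B) (a, d) (b, c) := by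
    intro A B
    conv_lhs => rw [PingPong.matrix_eq_sum_single A]
    simp only [map_sum, map_smul, Finset.sum_mul, Matrix.trace_sum, Matrix.smul_mul,
      Matrix.trace_smul, Matrix.kroneckerMap_apply]
    refine Finset.sum_congr rfl fun a _ => Finset.sum_congr rfl fun b _ => ?_
    simp only [Matrix.trace, Matrix.diag, Matrix.mul_apply, smul_eq_mul, Finset.mul_sum]
    exact Finset.sum_congr rfl fun c _ => Finset.sum_congr rfl fun d _ => by ring
  have hint : ∀ a b c d, Integrable (fun V => Ψ (Matrix.single a b 1) c d *
      (pureState V ⊗ₖ pureState V) (a, d) (b, c)) (haarUnitary (Qubits Q)) := by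
    intro a b c d
    refine integrable_of_continuous _ (continuous_const.mul ?_)
    simp only [Matrix.kroneckerMap_apply]
    exact (continuous_pureState.matrix_elem _ _).mul (continuous_pureState.matrix_elem _ _)
  simp only [key]
  rw [integral_finsetSum _ fun a _ => integrable_finsetSum _ fun b _ =>
    integrable_finsetSum _ fun c _ => integrable_finsetSum _ fun d _ => hint a b c d]
  simp only [integral_finsetSum _ fun b _ =>
    integrable_finsetSum _ fun c _ => integrable_finsetSum _ fun d _ => hint _ b c d,
    integral_finsetSum _ fun c _ => integrable_finsetSum _ fun d _ => hint _ _ c d,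
    integral_finsetSum _ fun d _ => hint _ _ _ d, integral_const_mul, ← hx.design]
  simp only [Finset.mul_sum]
  rw [Finset.sum_comm]
  refine Finset.sum_congr rfl fun a _ => ?_
  rw [Finset.sum_comm]
  refine Finset.sum_congr rfl fun b _ => ?_
  rw [Finset.sum_comm]
  refine Finset.sum_congr rfl fun c _ => ?_
  rw [Finset.sum_comm]
  exact Finset.sum_congr rfl fun d _ => Finset.sum_congr rfl fun i _ => by ring

/-- Brings the depolarizing form into the shape that a 2-design averages. -/
theorem exists_depolarizingForm_eq (q : ℝ) (Λ : Superop (Qubits Q)) :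
    ∃ Ψ : Superop (Qubits Q), ∀ A B, depolarizingForm q (Λ A) B = (Ψ A * B).trace := by
  refine ⟨(q : ℂ) • Λ + ((1 - q) * (2 ^ Q)⁻¹ : ℂ) •
    ((Matrix.traceLinearMap (Qubits Q) ℂ ℂ).smulRight 1 ∘ₗ Λ), fun A B => ?_⟩
  simp [depolarizingForm, add_mul, mul_assoc]

/-- The success probability of the test in terms of the depolarizing parameters. -/
theorem successProb_eq (hQ : Q ≠ 0) {ι : Type*} [Fintype ι] {x : ι → Qubits Q → ℂ}
    (hx : IsProjectiveTwoDesign x) (𝒩 : NoiseModel) {k : ℕ} (hk : k ≠ 0) :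
    successProb x 𝒩 k =
      (2 ^ Q)⁻¹ + (1 - (2 ^ Q)⁻¹) * ∏ j ∈ Finset.range k, roundParam Q 𝒩 j := by
  obtain ⟨k, rfl⟩ := Nat.exists_eq_succ_of_ne_zero hk
  have hC := ncard_cliffordGroup_pos (Q := Q)
  obtain ⟨Ψ, hΨ⟩ := exists_depolarizingForm_eq
    (∏ j ∈ Finset.range k, roundParam Q 𝒩 (j + 1)) (roundError Q 𝒩 0)
  have hgate : ∀ c : Fin (k + 1) → cliffordGroup Q,
      (fun j => (c j : Superop (Qubits Q))) = cliffordGates (fun _ => 1) c := fun c => by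
    ext1 j
    rw [cliffordGates, unitaryChannel_one, LinearMap.comp_id]
  have hterm : ∀ i, (((cliffordGroup Q).ncard : ℝ) ^ (k + 1))⁻¹ *
      ∑ᶠ c : Fin (k + 1) → cliffordGroup Q, acceptProb 𝒩 (x i)
        (fun j => (c j : Superop (Qubits Q))) =
      ((Ψ (vecMulVec (x i) (star (x i))) * vecMulVec (x i) (star (x i))).trace).re := by
    intro i
    simp only [finsum_eq_sum_of_fintype, acceptProb, hgate, ← Complex.re_sum,
      sum_trace_cliffordGates hQ, re_ncard_pow_mul, hΨ]
    rw [inv_mul_cancel_left₀ (pow_pos hC _).ne']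
  have havg := congrArg Complex.re (hx.average_trace Ψ)
  rw [← Complex.ofReal_natCast, ← Complex.ofReal_inv, Complex.re_ofReal_mul, Complex.re_sum] at havg
  have hint : Integrable (fun V => (Ψ (pureState V) * pureState V).trace)
      (haarUnitary (Qubits Q)) := integrable_of_continuous _ (continuous_trace_mul
    ((continuous_superop Ψ).comp continuous_pureState) continuous_pureState)
  have hI : (∫ V, (Ψ (pureState V) * pureState V).trace ∂(haarUnitary (Qubits Q))).re =
      ∫ V, ((Ψ (pureState V) * pureState V).trace).re ∂(haarUnitary (Qubits Q)) :=
    (integral_re hint).symm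
  rw [successProb]
  simp only [hterm]
  rw [havg, hI]
  simp only [← hΨ]
  rw [integral_depolarizingForm hQ (hasKraus_roundError 𝒩 0), Finset.prod_range_succ']
  rfl

end HaarAverage

/-! ### The bound for protocols -/

section ProtocolBound

variable {Q k : ℕ}

theorem bipartite_eq_submatrix (S : Finset (Fin Q))
    (GA : Matrix ({i // i ∈ S} → Fin 2) ({i // i ∈ S} → Fin 2) ℂ)
    (GB : Matrix ({i // i ∉ S} → Fin 2) ({i // i ∉ S} → Fin 2) ℂ) :
    bipartite S GA GB = (GA ⊗ₖ GB).submatrix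
      (Equiv.piEquivPiSubtypeProd (fun i => i ∈ S) fun _ => Fin 2)
      (Equiv.piEquivPiSubtypeProd (fun i => i ∈ S) fun _ => Fin 2) := rfl

/-- The unitary `G_A ⊗ G_B` of round `j`. -/
def Protocol.unitary (P : Protocol Q k) (j : Fin k) : unitaryGroup (Qubits Q) ℂ :=
  ⟨bipartite (P.atA j) (P.gateA j) (P.gateB j), by
    rw [Matrix.mem_unitaryGroup_iff, Matrix.star_eq_conjTranspose, bipartite_eq_submatrix,
      Matrix.conjTranspose_submatrix, Matrix.submatrix_mul_equiv, Matrix.conjTranspose_kronecker,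
      ← Matrix.mul_kronecker_mul, unitary_mul_conjTranspose_self, unitary_mul_conjTranspose_self,
      Matrix.one_kronecker_one, Matrix.submatrix_one_equiv]⟩

theorem Protocol.gate_eq (P : Protocol Q k) (j : Fin k) :
    P.gate j = unitaryChannel (P.unitary j) := rfl

/-- The ideal memory is absorbed into the gate unitary, so both runs are products of the same
unitaries, with and without the error channels. -/
theorem Protocol.diamondDist_le (P : Protocol Q k) (𝒩 : NoiseModel) :
    diamondDist (P.noisy 𝒩) (P.ideal 𝒩) ≤ ENNReal.ofReal (∑ j ∈ Finset.range k,
      (2 ^ Q + √(2 ^ Q) + 1) * √(1 - entanglementFidelity (roundError Q 𝒩 j))) := by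
  have h := diamondDist_compose_le (k := k)
    (fun j => P.unitary j * tensorUnitary Q (𝒩.memory j)) (Λ := fun j => roundError Q 𝒩 j)
    fun j => hasKraus_roundError 𝒩 j
  have h1 : P.noisy 𝒩 = compose k fun j =>
      unitaryChannel (P.unitary j * tensorUnitary Q (𝒩.memory j)) ∘ₗ roundError Q 𝒩 j :=
    congrArg (compose k) (funext fun j => by
      rw [noisyRound_eq, P.gate_eq, unitaryChannel_mul, LinearMap.comp_assoc])
  have h2 : P.ideal 𝒩 = compose k fun j =>
      unitaryChannel (P.unitary j * tensorUnitary Q (𝒩.memory j)) :=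
    congrArg (compose k) (funext fun j => by rw [idealRound_eq, P.gate_eq, unitaryChannel_mul])
  have hcard : (Fintype.card (Qubits Q) : ℝ) = 2 ^ Q := by simp
  rw [hcard] at h
  rw [h1, h2, Finset.sum_range]
  exact h

/-- Covers $Q=0$, where the Hilbert space is one-dimensional and the formulas with $d^2-1$ in the
denominator fail. -/
theorem entanglementFidelity_eq_one_of_unique {n : Type} [Fintype n] [DecidableEq n] [Unique n]
    {Φ : Superop n} (hΦ : HasKraus Φ) : entanglementFidelity Φ = 1 := by
  have h := hΦ.trace (Matrix.single default default 1)
  simp only [Matrix.trace, Matrix.diag, Fintype.sum_unique, Matrix.single_apply_same] at h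
  simp [entanglementFidelity, h]

/-! ### From the fidelity of the test to the fidelities of the rounds -/

theorem four_le_two_pow_sq (hQ : Q ≠ 0) : (4 : ℝ) ≤ (2 ^ Q) ^ 2 := by
  have h : (2 : ℝ) ^ 1 ≤ 2 ^ Q := pow_le_pow_right₀ (by norm_num) (Nat.one_le_iff_ne_zero.mpr hQ)
  nlinarith

theorem sq_mul_one_sub_entanglementFidelity (hQ : Q ≠ 0) (𝒩 : NoiseModel) (j : ℕ) :
    ((2 : ℝ) ^ Q) ^ 2 * (1 - entanglementFidelity (roundError Q 𝒩 j)) =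
      ((2 ^ Q) ^ 2 - 1) * (1 - roundParam Q 𝒩 j) := by
  have h := four_le_two_pow_sq hQ
  have h' : ((2 : ℝ) ^ Q) ^ 2 - 1 ≠ 0 := by linarith
  rw [roundParam, depolarizingParam]
  field_simp
  ring

theorem roundParam_le_one (hQ : Q ≠ 0) (𝒩 : NoiseModel) (j : ℕ) : roundParam Q 𝒩 j ≤ 1 := by
  have h := four_le_two_pow_sq hQ
  have h1 := entanglementFidelity_le_one (hasKraus_roundError (Q := Q) 𝒩 j)
  rw [roundParam, depolarizingParam, div_le_one (by linarith)]
  nlinarith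

/-- $F\ge0$ gives $p\ge-1/(d^2-1)$, and $d\ge2$. -/
theorem neg_third_le_roundParam (hQ : Q ≠ 0) (𝒩 : NoiseModel) (j : ℕ) :
    -(1 / 3) ≤ roundParam Q 𝒩 j := by
  have h := four_le_two_pow_sq hQ
  have h1 := entanglementFidelity_nonneg (hasKraus_roundError (Q := Q) 𝒩 j)
  rw [roundParam, depolarizingParam, le_div_iff₀ (by linarith)]
  nlinarith

/-- The other factors have a product $r$ with $|r|\le1$. If $p_i\ge0$ then $p_ir\le p_i$. If
$p_i\le0$ then $p_ir\le-p_i$, and $1-p_i\le2(1+p_i)$ is exactly $p_i\ge-1/3$. -/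
theorem one_sub_le_two_mul_one_sub_prod {s : Finset ℕ} {p : ℕ → ℝ}
    (h0 : ∀ j, -(1 / 3) ≤ p j) (h1 : ∀ j, p j ≤ 1) {i : ℕ} (hi : i ∈ s) :
    1 - p i ≤ 2 * (1 - ∏ j ∈ s, p j) := by
  rw [← Finset.mul_prod_erase _ _ hi]
  have hr : |∏ j ∈ s.erase i, p j| ≤ 1 := by
    rw [Finset.abs_prod]
    exact Finset.prod_le_one (fun j _ => abs_nonneg _) fun j _ =>
      abs_le.mpr ⟨by linarith [h0 j], h1 j⟩
  obtain ⟨hr1, hr2⟩ := abs_le.mp hr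
  have hi0 := h0 i
  have hi1 := h1 i
  rcases le_total 0 (p i) with hp | hp <;> nlinarith

theorem sq_mul_le_four_pow (k : ℕ) : 25 * k ^ 2 ≤ 8 * 4 ^ k := by
  match k with
  | 0 => norm_num
  | 1 => norm_num
  | 2 => norm_num
  | k + 3 =>
    induction k with
    | zero => norm_num
    | succ k ih =>
      have h : 25 * (k + 1 + 3) ^ 2 ≤ 4 * (25 * (k + 3) ^ 2) := by
        nlinarith [Nat.zero_le k, Nat.zero_le (k ^ 2)]
      rw [show k + 1 + 3 = (k + 3) + 1 from rfl, pow_succ 4]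
      exact h.trans ((Nat.mul_le_mul_left 4 ih).trans_eq (by ring))

/-- Let $X=1-\prod_jp_j$. Each of the $k$ terms is at most $\sqrt{\tfrac{25}2(d^2-1)X}$, while the
right side is $2\sqrt{|\mathsf{Cliff}(d)|^k(d^2-1)X}$, since $d(d+1)(1-1/d)=d^2-1$. The comparison
reduces to $25k^2\le8\,|\mathsf{Cliff}(d)|^k$. -/
theorem sum_error_le (hQ : Q ≠ 0) (𝒩 : NoiseModel) (k : ℕ) :
    ∑ j ∈ Finset.range k,
        ((2 : ℝ) ^ Q + √(2 ^ Q) + 1) * √(1 - entanglementFidelity (roundError Q 𝒩 j)) ≤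
      2 * √((2 : ℝ) ^ Q * (2 ^ Q + 1)) * √(((cliffordGroup Q).ncard : ℝ) ^ k *
        (1 - ((2 ^ Q)⁻¹ + (1 - (2 ^ Q)⁻¹) * ∏ j ∈ Finset.range k, roundParam Q 𝒩 j))) := by
  set D : ℝ := (2 : ℝ) ^ Q with hD
  set X : ℝ := 1 - ∏ j ∈ Finset.range k, roundParam Q 𝒩 j with hX
  have hD2 : 2 ≤ D := by
    have h : (2 : ℝ) ^ 1 ≤ 2 ^ Q :=
      pow_le_pow_right₀ (by norm_num) (Nat.one_le_iff_ne_zero.mpr hQ)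
    simpa using h
  have hC : (4 : ℝ) ≤ (cliffordGroup Q).ncard := by
    have h1 := pow_le_ncard_cliffordGroup Q
    have h2 : 4 ^ 1 ≤ 4 ^ Q := Nat.pow_le_pow_right (by norm_num) (Nat.one_le_iff_ne_zero.mpr hQ)
    exact_mod_cast (by simpa using h2.trans h1 : 4 ≤ (cliffordGroup Q).ncard)
  have hterm : ∀ j ∈ Finset.range k,
      (D + √D + 1) * √(1 - entanglementFidelity (roundError Q 𝒩 j)) ≤
        √(25 / 2 * ((D ^ 2 - 1) * X)) := by
    intro j hj
    -- From $\sqrt d\le(d+1)/2$ and $d\ge2$.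
    have h1 : D + √D + 1 ≤ 5 / 2 * D := by
      have : √D ≤ (D + 1) / 2 := by
        rw [Real.sqrt_le_left (by linarith)]
        nlinarith [sq_nonneg (D - 1)]
      linarith
    have h2 := sq_mul_one_sub_entanglementFidelity hQ 𝒩 j
    rw [← hD] at h2
    have h3 : 1 - roundParam Q 𝒩 j ≤ 2 * X := one_sub_le_two_mul_one_sub_prod
      (neg_third_le_roundParam hQ 𝒩) (roundParam_le_one hQ 𝒩) hj
    have h4 := entanglementFidelity_le_one (hasKraus_roundError (Q := Q) 𝒩 j)
    apply Real.le_sqrt_of_sq_le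
    rw [mul_pow, Real.sq_sqrt (by linarith)]
    calc (D + √D + 1) ^ 2 * (1 - entanglementFidelity (roundError Q 𝒩 j))
        ≤ (5 / 2 * D) ^ 2 * (1 - entanglementFidelity (roundError Q 𝒩 j)) := by
          refine mul_le_mul_of_nonneg_right ?_ (by linarith)
          gcongr
      _ = 25 / 4 * ((D ^ 2 - 1) * (1 - roundParam Q 𝒩 j)) := by rw [← h2]; ring
      _ ≤ 25 / 4 * ((D ^ 2 - 1) * (2 * X)) := by
          have : 0 ≤ D ^ 2 - 1 := by nlinarith
          gcongr
      _ = _ := by ring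
  refine (Finset.sum_le_card_nsmul _ _ _ hterm).trans ?_
  rw [Finset.card_range, nsmul_eq_mul]
  rcases k.eq_zero_or_pos with rfl | hk
  · simp
  have hX0 : 0 ≤ X := by
    have h := one_sub_le_two_mul_one_sub_prod (neg_third_le_roundParam hQ 𝒩)
      (roundParam_le_one hQ 𝒩) (Finset.mem_range.mpr hk)
    have := roundParam_le_one hQ 𝒩 0
    linarith
  have hCk : (25 : ℝ) * k ^ 2 ≤ 8 * ((cliffordGroup Q).ncard : ℝ) ^ k := by
    have h1 : (25 : ℝ) * k ^ 2 ≤ 8 * 4 ^ k := by exact_mod_cast sq_mul_le_four_pow k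
    have h2 : (4 : ℝ) ^ k ≤ ((cliffordGroup Q).ncard : ℝ) ^ k := by gcongr
    linarith
  have hR : 1 - (D⁻¹ + (1 - D⁻¹) * ∏ j ∈ Finset.range k, roundParam Q 𝒩 j) = (1 - D⁻¹) * X := by
    rw [hX]; ring
  rw [hR, mul_assoc, ← Real.sqrt_mul (by positivity)]
  have h2 : ∀ a, 2 * √a = √(4 * a) := fun a => by
    rw [Real.sqrt_mul (by norm_num), show (4 : ℝ) = 2 ^ 2 by norm_num, Real.sqrt_sq (by norm_num)]
  have hk2 : ∀ a, (k : ℝ) * √a = √(k ^ 2 * a) := fun a => by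
    rw [Real.sqrt_mul (by positivity), Real.sqrt_sq (by positivity)]
  rw [h2, hk2]
  apply Real.sqrt_le_sqrt
  have hY : 0 ≤ (D ^ 2 - 1) * X := mul_nonneg (by nlinarith) hX0
  calc (k : ℝ) ^ 2 * (25 / 2 * ((D ^ 2 - 1) * X))
      = (25 * k ^ 2) * (((D ^ 2 - 1) * X) / 2) := by ring
    _ ≤ (8 * ((cliffordGroup Q).ncard : ℝ) ^ k) * (((D ^ 2 - 1) * X) / 2) := by gcongr
    _ = _ := by field_simp; ring

/-- The bound on the diamond distance for any quantity `S` that agrees with the fidelity of the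
test of depth `k`. -/
theorem Protocol.diamondDist_le_of_eq (P : Protocol Q k) (𝒩 : NoiseModel) {S : ℝ}
    (hS : Q ≠ 0 → k ≠ 0 →
      S = (2 ^ Q)⁻¹ + (1 - (2 ^ Q)⁻¹) * ∏ j ∈ Finset.range k, roundParam Q 𝒩 j) :
    diamondDist (P.noisy 𝒩) (P.ideal 𝒩) ≤ ENNReal.ofReal (2 * √((2 : ℝ) ^ Q * ((2 : ℝ) ^ Q + 1)) *
      √(((cliffordGroup Q).ncard : ℝ) ^ k * (1 - S))) := by
  refine (P.diamondDist_le 𝒩).trans (ENNReal.ofReal_le_ofReal ?_)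
  rcases eq_or_ne k 0 with rfl | hk
  · simp only [Finset.range_zero, Finset.sum_empty]; positivity
  rcases eq_or_ne Q 0 with rfl | hQ
  · simp only [entanglementFidelity_eq_one_of_unique (hasKraus_roundError 𝒩 _), sub_self,
      Real.sqrt_zero, mul_zero, Finset.sum_const_zero]
    positivity
  rw [hS hQ hk]
  exact sum_error_le hQ 𝒩 k

theorem term_le_sum (hk : k ≠ 0) (f : ℕ → ℝ) {c : ℝ} (hc : 0 ≤ c) :
    ENNReal.ofReal (c * √(f k)) ≤ ENNReal.ofReal (c * ∑ κ ∈ Finset.Icc 1 k, √(f κ)) :=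
  ENNReal.ofReal_le_ofReal <| mul_le_mul_of_nonneg_left
    (Finset.single_le_sum (f := fun κ => √(f κ)) (fun _ _ => Real.sqrt_nonneg _)
      (Finset.mem_Icc.mpr ⟨Nat.one_le_iff_ne_zero.mpr hk, le_rfl⟩)) hc

theorem Protocol.diamondDist_eq_zero (P : Protocol Q 0) (𝒩 : NoiseModel) :
    diamondDist (P.noisy 𝒩) (P.ideal 𝒩) = 0 := by
  simpa using P.diamondDist_le 𝒩

/-- Hoeffding's inequality for the winning rate. -/
theorem IsTestRecord.measureReal_le {ι Ω : Type*} [Fintype ι] [MeasurableSpace Ω] {μ : Measure Ω}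
    [IsProbabilityMeasure μ] {x : ι → Qubits Q → ℂ} {𝒩 : NoiseModel} {κ N : ℕ}
    {v : Fin N → Ω → Bool} (h : IsTestRecord μ x 𝒩 κ N v) (hN : 0 < N) {ε : ℝ} (hε : 0 ≤ ε) :
    μ.real {ω | successProb x 𝒩 κ + ε ≤ winningRate v ω} ≤ Real.exp (-2 * N * ε ^ 2) := by
  let b : Bool → ℝ := fun t => if t = true then 1 else 0
  have hb : Measurable b := measurable_of_finite b
  have hm : ∀ i, Measurable fun ω => b (v i ω) := fun i => hb.comp (h.measurable i)
  have hmean : ∀ i, ∫ ω, b (v i ω) ∂μ = successProb x 𝒩 κ := by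
    intro i
    have hset : MeasurableSet {ω | v i ω = true} := h.measurable i (measurableSet_singleton true)
    have he : (fun ω => b (v i ω)) = {ω | v i ω = true}.indicator 1 := by
      ext ω
      by_cases hv : v i ω = true <;> simp [b, hv]
    rw [he, integral_indicator_one hset, h.law i]
  -- A variable with values in $[0,1]$ has sub-Gaussian parameter $1/4$ after centering, which turns
  -- the exponent $-(N\varepsilon)^2/(2\cdot N/4)$ into $-2N\varepsilon^2$.
  have hsub : ∀ i ∈ Finset.univ, HasSubgaussianMGF
      (fun ω => b (v i ω) - successProb x 𝒩 κ) ((‖(1 : ℝ) - 0‖₊ / 2) ^ 2) μ := by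
    intro i _
    have := hasSubgaussianMGF_of_mem_Icc (μ := μ) (X := fun ω => b (v i ω)) (a := 0) (b := 1)
      (hm i).aemeasurable (Filter.Eventually.of_forall fun ω => by
        by_cases hv : v i ω = true <;> simp [b, hv])
    rwa [hmean i] at this
  have hind : iIndepFun (fun i ω => b (v i ω) - successProb x 𝒩 κ) μ :=
    h.indep.comp (fun _ t => b t - successProb x 𝒩 κ) fun _ => measurable_of_finite _
  have hN' : (0 : ℝ) < N := by exact_mod_cast hN
  have hH := HasSubgaussianMGF.measure_sum_ge_le_of_iIndepFun hind hsub
    (ε := N * ε) (by positivity)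
  have hset : {ω | successProb x 𝒩 κ + ε ≤ winningRate v ω} =
      {ω | N * ε ≤ ∑ i, (b (v i ω) - successProb x 𝒩 κ)} := by
    ext ω
    simp only [Set.mem_ofPred_eq, winningRate, le_div_iff₀ hN', Finset.sum_sub_distrib,
      Finset.sum_const, Finset.card_univ, Fintype.card_fin, nsmul_eq_mul, b]
    constructor <;> intro h <;> linarith
  rw [hset]
  refine hH.trans_eq ?_
  congr 1
  simp only [sub_zero, nnnorm_one, Finset.sum_const, Finset.card_univ, Fintype.card_fin,
    nsmul_eq_mul]
  push_cast
  field_simp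

theorem one_sub_le_measureReal_of_forall_notMem {Ω : Type*} [MeasurableSpace Ω] (μ : Measure Ω)
    [IsProbabilityMeasure μ] {G B : Set Ω} (h : ∀ ω, ω ∉ B → ω ∈ G) : 1 - μ.real B ≤ μ.real G := by
  have h1 : G ∪ B = Set.univ := by
    ext ω; simp only [Set.mem_union, Set.mem_univ, iff_true]
    by_cases hω : ω ∈ B
    · exact Or.inr hω
    · exact Or.inl (h ω hω)
  have h2 := measureReal_union_le (μ := μ) G B
  rw [h1, probReal_univ] at h2
  linarith

end ProtocolBound

end PingPong

end

/-! ### The theorem -/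

theorem mainTheorem6 (Q k : ℕ) (𝒩 : PingPong.NoiseModel) (P : PingPong.Protocol Q k) :
    PingPong.diamondDist (P.noisy 𝒩) (P.ideal 𝒩) ≤
        ENNReal.ofReal (2 * √((2 : ℝ) ^ Q * ((2 : ℝ) ^ Q + 1)) *
          ∑ κ ∈ Finset.Icc 1 k, √(((PingPong.cliffordGroup Q).ncard : ℝ) ^ κ *
            (1 - PingPong.doubleAvgFidelity Q 𝒩 κ))) ∧
    PingPong.diamondDist (P.noisy 𝒩) (P.ideal 𝒩) ≤
        ENNReal.ofReal (2 * √((2 : ℝ) ^ Q * ((2 : ℝ) ^ Q + 1)) *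
          √(((PingPong.cliffordGroup Q).ncard : ℝ) ^ k *
            (1 - PingPong.doubleAvgFidelity Q 𝒩 k))) ∧
    ∀ (ι Ω : Type*) [Fintype ι] [MeasurableSpace Ω] (μ : MeasureTheory.Measure Ω)
      [MeasureTheory.IsProbabilityMeasure μ] (x : ι → PingPong.Qubits Q → ℂ)
      (N : ℕ → ℕ) (v : (κ : ℕ) → Fin (N κ) → Ω → Bool) (ε : ℕ → ℝ),
      PingPong.IsProjectiveTwoDesign x →
      (∀ κ ∈ Finset.Icc 1 k, 0 < N κ ∧ 0 ≤ ε κ ∧ PingPong.IsTestRecord μ x 𝒩 κ (N κ) (v κ)) →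
      1 - ∑ κ ∈ Finset.Icc 1 k, Real.exp (-2 * N κ * ε κ ^ 2) ≤
        μ.real {ω | PingPong.diamondDist (P.noisy 𝒩) (P.ideal 𝒩) ≤
          ENNReal.ofReal (2 * √((2 : ℝ) ^ Q * ((2 : ℝ) ^ Q + 1)) *
            ∑ κ ∈ Finset.Icc 1 k, √(((PingPong.cliffordGroup Q).ncard : ℝ) ^ κ *
              (1 - PingPong.winningRate (v κ) ω + ε κ)))} := by
  have hc : (0 : ℝ) ≤ 2 * √((2 : ℝ) ^ Q * ((2 : ℝ) ^ Q + 1)) := by positivity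
  have hlast := P.diamondDist_le_of_eq 𝒩 (S := PingPong.doubleAvgFidelity Q 𝒩 k)
    fun hQ hk => PingPong.doubleAvgFidelity_eq hQ 𝒩 hk
  -- Without rounds the sums are empty, so the distance itself must be shown to vanish.
  rcases eq_or_ne k 0 with rfl | hk
  · refine ⟨?_, hlast, ?_⟩
    · simp [P.diamondDist_eq_zero]
    · intro ι Ω _ _ μ _ x N v ε _ _
      simp [P.diamondDist_eq_zero]
  refine ⟨hlast.trans (PingPong.term_le_sum hk (fun κ =>
    ((PingPong.cliffordGroup Q).ncard : ℝ) ^ κ * (1 - PingPong.doubleAvgFidelity Q 𝒩 κ)) hc),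
    hlast, ?_⟩
  intro ι Ω _ _ μ _ x N v ε hx hrec
  have hmem : k ∈ Finset.Icc 1 k := Finset.mem_Icc.mpr ⟨Nat.one_le_iff_ne_zero.mpr hk, le_rfl⟩
  obtain ⟨hN, hε, hv⟩ := hrec k hmem
  have hH := hv.measureReal_le hN hε
  -- Only the record of depth `k` is exploited; the other failure probabilities merely weaken the
  -- claim.
  have hexp : Real.exp (-2 * N k * ε k ^ 2) ≤
      ∑ κ ∈ Finset.Icc 1 k, Real.exp (-2 * N κ * ε κ ^ 2) :=
    Finset.single_le_sum (f := fun κ => Real.exp (-2 * N κ * ε κ ^ 2))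
      (fun _ _ => (Real.exp_pos _).le) hmem
  -- The bad event is that the winning rate at depth `k` exceeds its mean by at least `ε k`. Outside
  -- it, $1-S\le1-R_k+\varepsilon_k$ for the true success probability $S$.
  refine le_trans (by linarith) (PingPong.one_sub_le_measureReal_of_forall_notMem μ
    (B := {ω | PingPong.successProb x 𝒩 k + ε k ≤ PingPong.winningRate (v k) ω}) ?_)
  intro ω hω
  have hω' : PingPong.winningRate (v k) ω < PingPong.successProb x 𝒩 k + ε k := not_le.mp hω
  refine le_trans ?_ (PingPong.term_le_sum hk (fun κ =>
    ((PingPong.cliffordGroup Q).ncard : ℝ) ^ κ * (1 - PingPong.winningRate (v κ) ω + ε κ)) hc)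
  refine (P.diamondDist_le_of_eq 𝒩 (S := PingPong.successProb x 𝒩 k)
    fun hQ hk => PingPong.successProb_eq hQ hx 𝒩 hk).trans (ENNReal.ofReal_le_ofReal ?_)
  gcongr
  linarith
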